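/- Let $d>1$ and $n\ge 2$. Write elements of the group $G(d,1,n)=(\mathbb Z/d\mathbb Z)\wr\mathfrak S_n$ as pairs $[\pi;a]$ with $\pi\in\mathfrak S_n$ and $a\in(\mathbb Z/d\mathbb Z)^n$, where $[\pi;a]$ is the $n\times n$ matrix sending $e_j$ to $\omega^{a_j}e_{\pi(j)}$, $\omega=e^{2\pi i/d}$. Let $G=G(d,d,n)$ be the subgroup of elements with $a_1+\dots+a_n=0$. Let $c$ be a Coxeter element of $G$, that is, a conjugate in $G$ of $[(1\,2\cdots n-1)(n);(0,\dots,0,a,-a)]$ for some generator $a$ of $\mathbb Z/d\mathbb Z$; for example $c_{(d,d,n)}=[(1\,2\cdots n-1)(n);(0,\dots,0,1,-1)]$. A factorization $c=u_1\cdots u_k$ with $u_1,\dots,u_k\in G$ is called transitive if the subgroup generated by $u_1,\dots,u_k$ acts transitively on the set $\{\omega^ie_j : 0\le i<d,\ 1\le j\le n\}$. Let $b^{(d)}_{r_1,\dots,r_k}$ be the number of transitive factorizations $c=u_1\cdots u_k$ in $G$ such that the fixed space of $u_i$ in $\mathbb C^n$ has dimension $r_i$ for $i=1,\dots,k$. For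 $p\ge 1$ put $$P_p(x)=(x-(p-1)(d-1))\cdot\prod_{i=0}^{p-2}(x-1-id),$$ and for $p_1,\dots,p_k\ge 0$ put $$M^n_{p_1,\dots,p_k}=\sum_{t=0}^{\min(p_i)}(-1)^t\binom nt\prod_{i=1}^k\binom{n-t}{p_i-t}.$$ Then, as polynomial identities, $$\frac{n}{(n-1)\,|G|}\sum_{r,s\ge0}b^{(d)}_{r,s}x^ry^s=\sum_{p,q\ge1}\binom{n-2}{p-1;\,q-1;\,n-p-q}\frac{P_p(x)}{d^{p-1}p!}\cdot\frac{P_q(y)}{d^{q-1}q!},$$ where $\binom{N}{a;b;N-a-b}$ is the multinomial coefficient $N!/(a!\,b!\,(N-a-b)!)$, which is $0$ if $a+b>N$; and, more generally, for every $k\ge1$, $$\frac{n^k}{|G|^{k-1}}\sum_{r_1,\dots,r_k\ge0}b^{(d)}_{r_1,\dots,r_k}x_1^{r_1}\cdots x_k^{r_k}=\sum_{p_1,\dots,p_k\ge1}M^n_{p_1,\dots,p_k}\prod_{i=1}^k\frac{P_{p_i}(x_i)}{d^{p_i-1}(p_i-1)!}.$$ -/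

import Mathlib

/-- An element `[π; a]` of the group `G(d,1,n)`: a permutation `π` of `n` letters (the underlying
permutation) together with a tuple `a` of weights in `ℤ/d`.  It stands for the generalized
permutation matrix that sends `e_j` to `ω ^ (a j) • e_{π j}`, where `ω = exp (2πi/d)`. -/
@[ext]
structure GenPerm (d n : ℕ) where
  /-- the underlying permutation -/
  perm : Equiv.Perm (Fin n)
  /-- the weights -/
  weight : Fin n → ZMod d

namespace GenPerm

/-- The product `[π; a] · [σ; b] = [πσ; σ(a) + b]`, where `σ(a) j = a (σ j)`. -/
instance instMul (d n : ℕ) : Mul (GenPerm d n) :=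
  ⟨fun u v => ⟨u.perm * v.perm, fun j => u.weight (v.perm j) + v.weight j⟩⟩

instance instOne (d n : ℕ) : One (GenPerm d n) := ⟨⟨1, fun _ => 0⟩⟩

instance instInv (d n : ℕ) : Inv (GenPerm d n) :=
  ⟨fun u => ⟨u.perm⁻¹, fun j => - u.weight (u.perm⁻¹ j)⟩⟩

@[simp] theorem mul_perm {d n : ℕ} (u v : GenPerm d n) : (u * v).perm = u.perm * v.perm := rfl

@[simp] theorem mul_weight {d n : ℕ} (u v : GenPerm d n) (j : Fin n) :
    (u * v).weight j = u.weight (v.perm j) + v.weight j := rfl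

@[simp] theorem one_perm {d n : ℕ} : (1 : GenPerm d n).perm = 1 := rfl

@[simp] theorem one_weight {d n : ℕ} (j : Fin n) : (1 : GenPerm d n).weight j = 0 := rfl

@[simp] theorem inv_perm {d n : ℕ} (u : GenPerm d n) : (u⁻¹).perm = u.perm⁻¹ := rfl

@[simp] theorem inv_weight {d n : ℕ} (u : GenPerm d n) (j : Fin n) :
    (u⁻¹).weight j = - u.weight (u.perm⁻¹ j) := rfl

/-- `GenPerm d n` is the group `G(d,1,n)`. -/
instance instGroup (d n : ℕ) : Group (GenPerm d n) :=
  Group.ofLeftAxioms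
    (fun u v w => by ext j <;> simp [add_assoc])
    (fun u => by ext j <;> simp)
    (fun u => by ext j <;> simp)

/-- The natural action of `G(d,1,n)` on the set of the `d n` vectors `ω ^ i • e_j`; this vector
is encoded as the pair `(j, i)`. -/
instance instMulAction (d n : ℕ) : MulAction (GenPerm d n) (Fin n × ZMod d) where
  smul u x := (u.perm x.1, x.2 + u.weight x.1)
  one_smul x := by
    change ((1 : Equiv.Perm (Fin n)) x.1, x.2 + 0) = x
    simp
  mul_smul u v x := by
    change ((u.perm * v.perm) x.1, x.2 + (u.weight (v.perm x.1) + v.weight x.1)) =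
      (u.perm (v.perm x.1), x.2 + v.weight x.1 + u.weight (v.perm x.1))
    simp [add_assoc, add_comm]

/-- The generalized permutation matrix of `[π; a]`: column `j` has its nonzero entry
`ω ^ (a j)`, `ω = exp (2πi/d)`, in row `π j`. -/
noncomputable def toMatrix {d n : ℕ} (u : GenPerm d n) : Matrix (Fin n) (Fin n) ℂ :=
  Matrix.of fun i j =>
    if i = u.perm j then Complex.exp (2 * Real.pi * Complex.I / d) ^ (u.weight j).val else 0

/-- The dimension of the fixed space `{v ∈ ℂⁿ : w v = v}` of `w`. -/
noncomputable def fixDim {d n : ℕ} (w : GenPerm d n) : ℕ :=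
  Module.finrank ℂ (Module.End.eigenspace (Matrix.toLin' w.toMatrix) 1)

end GenPerm

/-- The group `G(d,d,n)`: the elements of `G(d,1,n)` of total weight `0`, i.e. the generalized
permutation matrices whose nonzero entries multiply to `1`. -/
def Gddn (d n : ℕ) : Subgroup (GenPerm d n) where
  carrier := {u | ∑ j, u.weight j = 0}
  one_mem' := by simp
  mul_mem' {u v} hu hv := by
    have h : ∑ j, u.weight (v.perm j) = ∑ j, u.weight j := Equiv.sum_comp v.perm u.weight
    simp only [Set.mem_ofPred_eq] at hu hv ⊢
    simp [Finset.sum_add_distrib, h, hu, hv]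
  inv_mem' {u} hu := by
    have h : ∑ j, u.weight (u.perm⁻¹ j) = ∑ j, u.weight j := Equiv.sum_comp u.perm⁻¹ u.weight
    simp only [Set.mem_ofPred_eq] at hu ⊢
    simp only [GenPerm.inv_weight, Finset.sum_neg_distrib, h, hu, neg_zero]

/-- The element `[(1 2 ⋯ n-1)(n); (0, …, 0, a, -a)]` of `G(d,d,n)`, for `n ≥ 2`
(the letters `1, …, n` are `0, …, n-1` here).  For `a = 1` it is `c_{(d,d,n)}`. -/
def coxeterElement (d n : ℕ) (hn : 2 ≤ n) (a : ZMod d) : Gddn d n :=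
  ⟨⟨Fin.cycleRange ⟨n - 2, by omega⟩,
    fun j => if (j : ℕ) = n - 2 then a else if (j : ℕ) = n - 1 then -a else 0⟩, by
    obtain ⟨m, rfl⟩ : ∃ m, n = m + 2 := ⟨n - 2, by omega⟩
    change ∑ j : Fin (m + 2), (if (j : ℕ) = m + 2 - 2 then a
      else if (j : ℕ) = m + 2 - 1 then -a else 0) = 0
    rw [Fin.sum_univ_castSucc, Fin.sum_univ_castSucc, Finset.sum_eq_zero]
    · simp
    · intro i _
      have := i.isLt
      rw [if_neg, if_neg]
      · simp only [Fin.val_castSucc]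
        omega
      · simp only [Fin.val_castSucc]
        omega⟩

/-- The Coxeter elements of `G(d,d,n)`: the conjugates in `G(d,d,n)` of
`[(1 2 ⋯ n-1)(n); (0, …, 0, a, -a)]`, where `a` is a cyclic generator of `ℤ/d`. -/
def IsCoxeterElement (d n : ℕ) (hn : 2 ≤ n) (c : Gddn d n) : Prop :=
  ∃ a : (ZMod d)ˣ, IsConj (coxeterElement d n hn a) c

/-- `b_{r_1,…,r_k}`: the number of transitive factorizations `c = u_1 ⋯ u_k` in `G(d,d,n)` in which
`u_i` has fixed space dimension `r_i`.  Transitive: the subgroup generated by the factors acts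
transitively on the set of the `d n` vectors `ω ^ i • e_j`. -/
noncomputable def transFactCount {d n : ℕ} (c : Gddn d n) {k : ℕ} (r : Fin k → ℕ) : ℕ :=
  Nat.card {u : Fin k → Gddn d n //
    (List.ofFn u).prod = c ∧
    MulAction.IsPretransitive (Subgroup.closure (Set.range u)) (Fin n × ZMod d) ∧
    ∀ i, (u i : GenPerm d n).fixDim = r i}

/-- `M^n_{p_1,…,p_k} = ∑_{t=0}^{min p_i} (-1)^t C(n,t) ∏_i C(n-t, p_i-t)` (for `k ≥ 1`). -/
noncomputable def coeffM (n : ℕ) {k : ℕ} (p : Fin k → ℕ) : ℤ :=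
  ∑ t ∈ Finset.range ((⨅ i, p i) + 1),
    (-1) ^ t * (n.choose t : ℤ) * ∏ i, ((n - t).choose (p i - t) : ℤ)

/-- `(x - 1)^{(d)}_p = (x - 1)(x - 1 - d) ⋯ (x - 1 - (p - 1) d)`. -/
noncomputable def stepFalling (d p : ℕ) : Polynomial ℚ :=
  ∏ i ∈ Finset.range p, (Polynomial.X - Polynomial.C (1 + (i : ℚ) * d))

/-- `P_p(x) = (x - (p - 1)(d - 1)) (x - 1)^{(d)}_{p - 1}` for `p ≥ 1`, and `P_0 = 1`. -/
noncomputable def polyP (d : ℕ) : ℕ → Polynomial ℚ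
  | 0 => 1
  | p + 1 => (Polynomial.X - Polynomial.C ((p : ℚ) * ((d : ℚ) - 1))) * stepFalling d p

/-- The multinomial coefficient `N! / (a! b! (N - a - b)!)`, which is `0` if `a + b > N`. -/
def trinomial (N a b : ℕ) : ℚ :=
  if a + b ≤ N then
    (N.factorial : ℚ) / (a.factorial * b.factorial * (N - a - b).factorial)
  else 0

/-! The sums of the theorem run over infinite index sets, but have only finitely many nonzero
terms, by the following facts. -/

theorem GenPerm.fixDim_le {d n : ℕ} (w : GenPerm d n) : w.fixDim ≤ n := by
  have h := Submodule.finrank_le (Module.End.eigenspace (Matrix.toLin' w.toMatrix) 1)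
  simpa [GenPerm.fixDim] using h

theorem transFactCount_eq_zero {d n : ℕ} (c : Gddn d n) {k : ℕ} (r : Fin k → ℕ) (i : Fin k)
    (hi : n < r i) : transFactCount c r = 0 := by
  have : IsEmpty {u : Fin k → Gddn d n //
      (List.ofFn u).prod = c ∧
      MulAction.IsPretransitive (Subgroup.closure (Set.range u)) (Fin n × ZMod d) ∧
      ∀ i, (u i : GenPerm d n).fixDim = r i} :=
    ⟨fun u => absurd (GenPerm.fixDim_le (u.1 i : GenPerm d n)) (by rw [u.2.2.2 i]; omega)⟩
  exact Nat.card_of_isEmpty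

theorem coeffM_eq_zero (n : ℕ) {k : ℕ} (p : Fin k → ℕ) (i : Fin k) (hi : n < p i) :
    coeffM n p = 0 := by
  refine Finset.sum_eq_zero fun t _ => ?_
  rcases le_or_gt t n with ht | ht
  · have : ((n - t).choose (p i - t) : ℤ) = 0 := by
      rw [Nat.choose_eq_zero_of_lt (by omega)]; rfl
    rw [Finset.prod_eq_zero (Finset.mem_univ i) this, mul_zero]
  · rw [Nat.choose_eq_zero_of_lt ht]; simp

/-!
The fixed space of `[π; a]` has one dimension for each cycle of `π` on which the weights `a` sum to
zero, so `x ^ dim` is a product over the cycles of `π`.  If `π₁, …, π_k` is a transitive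
factorization of the permutation of `c`, then the lifts of it to factorizations of `c` realize all
tuples of cycle weights in which the weights of each factor add up to zero, each of them equally
often.  Fourier inversion on `ℤ/d` resolves this constraint: the trivial character evaluates the
cycle enumerator of `πᵢ` at `(x + d - 1) / d`, and the `d - 1` other ones at `(x - 1) / d`.

It remains to count factorizations of an `(n - 1)`-cycle in `𝔖_n`, and these are transitive when not
all factors fix the remaining point.  In the group algebra, the sum of the long cycles splits into
components in the blocks of the hook partitions, built by adding one box at a time to the arm or
the leg with the help of Jucys–Murphy elements.  By Jucys' theorem the cycle enumerator acts on a
component by the product of `x + c` over the contents `c` of the boxes, so the count becomes an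
alternating sum over hooks of products of content polynomials.  Vandermonde's identity rewrites
these in the basis `P_p` and produces the coefficients `M^n_{p₁,…,p_k}`.
-/

section TransitiveFactorizations

open Equiv
open scoped Finset Nat

/-! ### Cycles of permutations and the group algebra -/

theorem apply_eq_of_mem_closure {α β : Type*} {f : α → β} {S : Set (Perm α)}
    (hS : ∀ g ∈ S, ∀ x, f (g x) = f x) {g : Perm α} (hg : g ∈ Subgroup.closure S) (x : α) :
    f (g x) = f x := by
  induction hg using Subgroup.closure_induction generalizing x with
  | mem g hg => exact hS g hg x
  | one => rfl
  | mul g h _ _ ihg ihh => rw [Perm.mul_apply, ihg, ihh]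
  | inv g _ ih => simpa using (ih (g⁻¹ x)).symm

/-- The set of cycles (including fixed points) of a permutation. -/
def CycleSet {α : Type*} (π : Perm α) : Type _ := Quotient (Perm.SameCycle.setoid π)

namespace CycleSet

variable {α β : Type*} {π : Perm α}

/-- The cycle of a point. -/
def mk (π : Perm α) (x : α) : CycleSet π := Quotient.mk (Perm.SameCycle.setoid π) x

theorem mk_surjective (π : Perm α) : Function.Surjective (mk π) := Quotient.mk_surjective

theorem mk_eq_mk {x y : α} : mk π x = mk π y ↔ π.SameCycle x y := Quotient.eq

@[simp] theorem mk_apply (x : α) : mk π (π x) = mk π x :=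
  mk_eq_mk.2 (Perm.sameCycle_apply_left.2 (Perm.SameCycle.refl π x))

theorem eq_of_invariant {f : α → β} (hf : ∀ x, f (π x) = f x) {x y : α}
    (h : mk π x = mk π y) : f x = f y := by
  obtain ⟨m, rfl⟩ := mk_eq_mk.1 h
  have hm : π ^ m ∈ Subgroup.closure {π} :=
    zpow_mem (Subgroup.subset_closure (Set.mem_singleton π)) m
  exact (apply_eq_of_mem_closure (by simpa using hf) hm x).symm

/-- A function invariant under a permutation descends to the set of its cycles. -/
def lift (f : α → β) (hf : ∀ x, f (π x) = f x) : CycleSet π → β :=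
  Quotient.lift f fun _ _ h => eq_of_invariant hf (mk_eq_mk.2 h)

@[simp] theorem lift_mk (f : α → β) (hf : ∀ x, f (π x) = f x) (x : α) :
    lift f hf (mk π x) = f x := rfl

instance [Finite α] : Finite (CycleSet π) := Finite.of_surjective _ (mk_surjective π)

noncomputable instance [Finite α] : Fintype (CycleSet π) := Fintype.ofFinite _

noncomputable instance : DecidableEq (CycleSet π) := Classical.decEq _

end CycleSet

/-- The number of cycles (including fixed points) of a permutation. -/
noncomputable def cycleCount {α : Type*} (π : Perm α) : ℕ := Nat.card (CycleSet π)

theorem cycleCount_eq_of_semiconj {α β : Type*} {π : Perm α} {ρ : Perm β} (e : α ≃ β)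
    (h : ∀ x, e (π x) = ρ (e x)) : cycleCount π = cycleCount ρ := by
  have h' : ∀ y, e.symm (ρ y) = π (e.symm y) := fun y => by
    rw [e.symm_apply_eq, h, e.apply_symm_apply]
  refine Nat.card_congr
    { toFun := CycleSet.lift (fun x => CycleSet.mk ρ (e x)) (fun x => by simp [h])
      invFun := CycleSet.lift (fun y => CycleSet.mk π (e.symm y)) (fun y => by simp [h'])
      left_inv := fun C => ?_
      right_inv := fun C => ?_ }
  · obtain ⟨x, rfl⟩ := CycleSet.mk_surjective _ C
    simp
  · obtain ⟨x, rfl⟩ := CycleSet.mk_surjective _ C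
    simp

theorem cycleCount_conj {α : Type*} (g π : Perm α) : cycleCount (g * π * g⁻¹) = cycleCount π :=
  (cycleCount_eq_of_semiconj g fun x => by simp).symm

theorem cycleCount_inv {α : Type*} (π : Perm α) : cycleCount π⁻¹ = cycleCount π :=
  Nat.card_congr (Quotient.congrRight fun _ _ => Perm.sameCycle_inv)

theorem cycleCount_optionCongr {α : Type*} [Finite α] (τ : Perm α) :
    cycleCount (optionCongr τ : Perm (Option α)) = cycleCount τ + 1 := by
  have e : CycleSet (optionCongr τ : Perm (Option α)) ≃ Option (CycleSet τ) :=
    { toFun := CycleSet.lift (Option.map (CycleSet.mk τ)) (fun x => by cases x <;> simp)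
      invFun := fun C => C.elim (CycleSet.mk _ none) (CycleSet.lift
        (fun x => CycleSet.mk _ (some x)) fun x => by
          rw [← CycleSet.mk_apply (some x)]; simp)
      left_inv := fun C => by
        obtain ⟨x, rfl⟩ := CycleSet.mk_surjective _ C
        cases x <;> simp
      right_inv := fun C => by
        rcases C with _ | C
        · simp
        · obtain ⟨x, rfl⟩ := CycleSet.mk_surjective _ C
          simp }
  rw [cycleCount, Nat.card_congr e, Finite.card_option, cycleCount]

theorem cycleCount_swap_mul_optionCongr {α : Type*} [DecidableEq α] (τ : Perm α) (j : α) :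
    cycleCount (swap none (some j) * optionCongr τ : Perm (Option α)) = cycleCount τ := by
  set ρ : Perm (Option α) := swap none (some j) * optionCongr τ with hρ
  have hnone : ρ none = some j := by simp [hρ]
  have hsome : ∀ x, CycleSet.mk ρ (some (τ x)) = CycleSet.mk ρ (some x) := fun x => by
    by_cases hx : τ x = j
    · rw [hx, ← hnone, CycleSet.mk_apply, ← CycleSet.mk_apply (some x)]
      simp [hρ, hx]
    · rw [← CycleSet.mk_apply (some x)]
      congr 1
      simp [hρ, swap_apply_of_ne_of_ne, hx]
  refine Nat.card_congr
    { toFun := CycleSet.lift (fun x => CycleSet.mk τ (x.getD j)) (fun x => ?_)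
      invFun := CycleSet.lift (fun x => CycleSet.mk ρ (some x)) hsome
      left_inv := fun C => ?_
      right_inv := fun C => ?_ }
  · rcases x with _ | x
    · simp [hnone]
    · by_cases hx : τ x = j
      · have : ρ (some x) = none := by simp [hρ, hx]
        rw [this]
        simp [← hx]
      · have : ρ (some x) = some (τ x) := by simp [hρ, swap_apply_of_ne_of_ne, hx]
        simp [this]
  · obtain ⟨x, rfl⟩ := CycleSet.mk_surjective _ C
    rcases x with _ | x
    · simp only [CycleSet.lift_mk, Option.getD_none]
      rw [← hnone, CycleSet.mk_apply]
    · simp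
  · obtain ⟨x, rfl⟩ := CycleSet.mk_surjective _ C
    simp

section GroupAlgebra

variable {α : Type*}

theorem cycleCount_pos [Finite α] [Nonempty α] (τ : Perm α) : 0 < cycleCount τ := by
  have : Nonempty (CycleSet τ) := ‹Nonempty α›.map (CycleSet.mk τ)
  exact Nat.card_pos

/-- The rational group algebra of the permutations of `α`. -/
abbrev PermAlg (α : Type*) := MonoidAlgebra ℚ (Perm α)

/-- A permutation as an element of the group algebra. -/
noncomputable abbrev permOf (g : Perm α) : PermAlg α := MonoidAlgebra.of ℚ (Perm α) g

/-- `∑ π, x ^ (number of cycles of π) • π`. -/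
noncomputable def cycleEnum (α : Type*) [Fintype α] [DecidableEq α] (x : ℚ) : PermAlg α :=
  ∑ π : Perm α, x ^ cycleCount π • permOf π

/-- The sum of the permutations with exactly one cycle. -/
noncomputable def longCycleSum (α : Type*) [Fintype α] [DecidableEq α] : PermAlg α :=
  ∑ π : Perm α with cycleCount π = 1, permOf π

/-- The sum of the transpositions that move `j`. -/
noncomputable def starSum [Fintype α] [DecidableEq α] (j : α) : PermAlg α :=
  ∑ i : α, if i = j then 0 else permOf (swap i j)

theorem permOf_mul (g h : Perm α) : permOf (g * h) = permOf g * permOf h := map_mul _ _ _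

theorem commute_sum_of_class_function [Fintype α] [DecidableEq α] {f : Perm α → ℚ}
    (hf : ∀ g π, f (g * π * g⁻¹) = f π) (g : Perm α) :
    Commute (permOf g) (∑ π, f π • permOf π) := by
  rw [Commute, SemiconjBy, Finset.mul_sum, Finset.sum_mul, ← Equiv.sum_comp (MulAut.conj g).toEquiv
    (fun π => f π • permOf π * permOf g)]
  refine Finset.sum_congr rfl fun π _ => ?_
  simp only [MulEquiv.toEquiv_eq_coe, MulEquiv.coe_toEquiv, MulAut.conj_apply, hf,
    mul_smul_comm, smul_mul_assoc, ← permOf_mul]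
  simp [mul_assoc]

theorem commute_cycleEnum [Fintype α] [DecidableEq α] (x : ℚ) (g : Perm α) :
    Commute (permOf g) (cycleEnum α x) :=
  commute_sum_of_class_function (fun g π => by rw [cycleCount_conj]) g

theorem commute_longCycleSum [Fintype α] [DecidableEq α] (g : Perm α) :
    Commute (permOf g) (longCycleSum α) := by
  simpa [longCycleSum, Finset.sum_filter] using commute_sum_of_class_function
    (f := fun π => if cycleCount π = 1 then 1 else 0) (fun g π => by rw [cycleCount_conj]) g

theorem permOf_mul_starSum [Fintype α] [DecidableEq α] (g : Perm α) (j : α) :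
    permOf g * starSum j = starSum (g j) * permOf g := by
  rw [starSum, starSum, Finset.mul_sum, Finset.sum_mul, ← Equiv.sum_comp g
    (fun i => (if i = g j then 0 else permOf (swap i (g j))) * permOf g)]
  refine Finset.sum_congr rfl fun i _ => ?_
  by_cases h : i = j
  · simp [h]
  · rw [if_neg h, if_neg (g.injective.ne h), ← permOf_mul, ← permOf_mul, Equiv.mul_swap_eq_swap_mul]

theorem commute_sum_starSum [Fintype α] [DecidableEq α] (g : Perm α) :
    Commute (permOf g) (∑ j : α, starSum j) := by
  rw [Commute, SemiconjBy, Finset.mul_sum, Finset.sum_mul,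
    ← Equiv.sum_comp g (fun j => starSum j * permOf g)]
  exact Finset.sum_congr rfl fun j _ => permOf_mul_starSum g j

/-- The embedding of permutations of `α` as permutations of `Option α` that fix `none`. -/
def optionCongrHom (α : Type*) : Perm α →* Perm (Option α) where
  toFun τ := optionCongr τ
  map_one' := optionCongr_one
  map_mul' σ τ := by ext x; cases x <;> simp

@[simp] theorem optionCongrHom_apply (τ : Perm α) : optionCongrHom α τ = optionCongr τ := rfl

/-- The embedding of the group algebra of `Perm α` into that of `Perm (Option α)`. -/
noncomputable def optionEmb (α : Type*) : PermAlg α →ₐ[ℚ] PermAlg (Option α) :=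
  MonoidAlgebra.mapDomainAlgHom ℚ ℚ (optionCongrHom α)

@[simp] theorem optionEmb_permOf (τ : Perm α) :
    optionEmb α (permOf τ) = permOf (optionCongr τ) := by
  simp [optionEmb, permOf]

theorem optionEmb_coeff_one (y : PermAlg α) : (optionEmb α y).coeff 1 = y.coeff 1 := by
  have h : Function.Injective (optionCongrHom α) := optionCongr_injective
  have := Finsupp.mapDomain_apply h y.coeff 1
  rw [map_one] at this
  exact this

theorem permOf_mul_optionEmb_coeff_one {g : Perm (Option α)} (hg : g none ≠ none)
    (y : PermAlg α) : (permOf g * optionEmb α y).coeff 1 = 0 := by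
  induction y using MonoidAlgebra.induction_on with
  | of τ =>
    rw [show MonoidAlgebra.of ℚ (Perm α) τ = permOf τ from rfl, optionEmb_permOf, ← permOf_mul]
    have : g * optionCongr τ ≠ 1 := fun h => hg (by simpa using congrArg (fun e => e none) h)
    simp [permOf, this]
  | add a b ha hb =>
    rw [map_add, mul_add, MonoidAlgebra.coeff_add, Finsupp.add_apply, ha, hb, add_zero]
  | smul r a ha => rw [map_smul, mul_smul_comm, MonoidAlgebra.coeff_smul_apply, ha, smul_zero]

variable [Fintype α] [DecidableEq α]

theorem starSum_none :
    (starSum (none : Option α)) = ∑ j : α, permOf (swap none (some j)) := by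
  rw [starSum, Fintype.sum_option]
  simp [swap_comm]

theorem starSum_some (j : α) :
    starSum (some j) = optionEmb α (starSum j) + permOf (swap none (some j)) := by
  rw [starSum, Fintype.sum_option, starSum, map_sum, add_comm]
  congr 1
  refine Finset.sum_congr rfl fun i _ => ?_
  by_cases h : i = j
  · simp [h]
  · rw [if_neg h, if_neg (by simpa using h), optionEmb_permOf, optionCongr_swap]

theorem sum_starSum_option :
    ∑ y : Option α, starSum y =
      optionEmb α (∑ j, starSum j) + (2 : ℚ) • starSum (none : Option α) := by
  rw [Fintype.sum_option, map_sum]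
  simp only [starSum_some, Finset.sum_add_distrib]
  rw [← starSum_none]
  module

theorem commute_starSum_none_optionEmb (y : PermAlg α) :
    Commute (starSum (none : Option α)) (optionEmb α y) := by
  induction y using MonoidAlgebra.induction_on with
  | of τ =>
    rw [show MonoidAlgebra.of ℚ (Perm α) τ = permOf τ from rfl, optionEmb_permOf]
    exact (by simpa using permOf_mul_starSum (optionCongr τ) none : _ * _ = _ * _).symm
  | add a b ha hb => rw [map_add]; exact ha.add_right hb
  | smul r a ha => rw [map_smul]; exact ha.smul_right r

theorem starSum_none_mul_swap (j : α) :
    starSum (none : Option α) * permOf (swap none (some j)) =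
      1 + permOf (swap none (some j)) * optionEmb α (starSum j) := by
  have h : starSum (none : Option α) * permOf (swap none (some j)) =
      permOf (swap none (some j)) * starSum (some j) := by
    rw [permOf_mul_starSum, swap_apply_right]
  rw [h, starSum_some, mul_add, ← permOf_mul, swap_mul_self, add_comm]
  simp [permOf, MonoidAlgebra.one_def]

theorem starSum_none_sq :
    starSum (none : Option α) * starSum (none : Option α) =
      (Fintype.card α : ℚ) • 1 +
        ∑ j : α, permOf (swap none (some j)) * optionEmb α (starSum j) := by
  conv_lhs => rw [starSum_none (α := α)]
  rw [← starSum_none, starSum_none, Finset.mul_sum, ← starSum_none]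
  simp only [starSum_none_mul_swap, Finset.sum_add_distrib]
  simp [Nat.cast_smul_eq_nsmul]

theorem sum_perm_option {M : Type*} [AddCommMonoid M] (f : Perm (Option α) → M) :
    ∑ π, f π = ∑ τ : Perm α, (f (optionCongr τ) +
      ∑ j : α, f (swap none (some j) * optionCongr τ)) := by
  rw [← Equiv.sum_comp Equiv.Perm.decomposeOption.symm f, Fintype.sum_prod_type,
    Fintype.sum_option, Finset.sum_comm, ← Finset.sum_add_distrib]
  simp [← Perm.one_def]

theorem cycleEnum_option (x : ℚ) :
    cycleEnum (Option α) x =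
      (x • 1 + starSum (none : Option α)) * optionEmb α (cycleEnum α x) := by
  rw [cycleEnum, sum_perm_option, cycleEnum, map_sum, Finset.mul_sum]
  refine Finset.sum_congr rfl fun τ _ => ?_
  simp only [cycleCount_optionCongr, cycleCount_swap_mul_optionCongr, map_smul, optionEmb_permOf,
    starSum_none, add_mul, mul_smul_comm, smul_mul_assoc, one_mul, Finset.sum_mul, permOf_mul,
    Finset.smul_sum, pow_succ, smul_add, smul_smul]

theorem longCycleSum_option [Nonempty α] :
    longCycleSum (Option α) = starSum (none : Option α) * optionEmb α (longCycleSum α) := by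
  rw [longCycleSum, Finset.sum_filter, sum_perm_option, longCycleSum, map_sum, Finset.mul_sum,
    Finset.sum_filter]
  refine Finset.sum_congr rfl fun τ _ => ?_
  have hτ : cycleCount τ + 1 ≠ 1 := by have := cycleCount_pos τ; omega
  rw [cycleCount_optionCongr, if_neg hτ, zero_add]
  simp only [cycleCount_swap_mul_optionCongr, optionEmb_permOf, starSum_none, Finset.sum_mul,
    permOf_mul]
  split_ifs <;> simp

theorem card_longCycles_option [Nonempty α] :
    #{π : Perm (Option α) | cycleCount π = 1} =
      Fintype.card α * #{π : Perm α | cycleCount π = 1} := by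
  have hτ : ∀ τ : Perm α, cycleCount τ + 1 ≠ 1 := fun τ => by have := cycleCount_pos τ; omega
  simp only [Finset.card_filter, sum_perm_option, cycleCount_optionCongr,
    cycleCount_swap_mul_optionCongr, hτ, if_false, zero_add, Finset.sum_const, Finset.card_univ,
    smul_eq_mul, Finset.mul_sum]

end GroupAlgebra

/-! ### Hook components of the long cycles -/

/-- The product of the factors `x + c` over the contents `c = -r, …, N - 1 - r` of the boxes of the
hook partition `(N - r, 1 ^ r)`; it makes sense for every rational `r`. -/
noncomputable def hookContentProd (N : ℕ) (r x : ℚ) : ℚ := (ascPochhammer ℚ N).eval (x - r)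

theorem hookContentProd_mul_arm (N : ℕ) (r x : ℚ) :
    hookContentProd N r x * (x + (N - r)) = hookContentProd (N + 1) r x := by
  rw [hookContentProd, hookContentProd, ascPochhammer_succ_eval]
  ring

theorem hookContentProd_mul_leg (N : ℕ) (r x : ℚ) :
    hookContentProd N r x * (x - (r + 1)) = hookContentProd (N + 1) (r + 1) x := by
  rw [hookContentProd, hookContentProd, ascPochhammer_succ_left]
  have h : x - (r + 1) + 1 = x - r := by ring
  simp [h, mul_comm]

/-- A decomposition of the sum of the long cycles into its components `K r` in the blocks of the
group algebra that belong to the hooks `(N - r, 1 ^ r)`, where `N` is the size of `α`. -/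
structure HookDecomposition (α : Type*) [Fintype α] [DecidableEq α] (K : ℕ → PermAlg α) :
    Prop where
  sum_eq : ∑ r ∈ Finset.range (Fintype.card α), K r = longCycleSum α
  eq_zero : ∀ r, Fintype.card α ≤ r → K r = 0
  sq : ∀ r j, starSum j * (starSum j * K r) =
    ((Fintype.card α : ℚ) - 1 - 2 * r) • (starSum j * K r) +
      ((r : ℚ) * (Fintype.card α - 1 - r)) • K r
  eigen : ∀ r x, cycleEnum α x * K r =
    hookContentProd (Fintype.card α) r x • K r
  total : ∀ r, (∑ j : α, starSum j) * K r =
    ((Fintype.card α : ℚ) * ((Fintype.card α : ℚ) - 1 - 2 * r)) • K r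
  coeff_one : ∀ r, (K r).coeff 1 =
    (-1) ^ r * ((Fintype.card α - 1).choose r : ℚ) / Fintype.card α

namespace HookDecomposition

variable {α : Type*} [Fintype α] [DecidableEq α] {K : ℕ → PermAlg α}

/-- The component of `K r` in the hook obtained by adding a box to the arm. -/
noncomputable def arm (K : ℕ → PermAlg α) (r : ℕ) : PermAlg (Option α) :=
  ((Fintype.card α : ℚ) + 1)⁻¹ • (starSum none * (starSum none * optionEmb α (K r)) +
    ((r : ℚ) + 1) • (starSum none * optionEmb α (K r)))

/-- The component of `K r` in the hook obtained by adding a box to the leg. -/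
noncomputable def leg (K : ℕ → PermAlg α) (r : ℕ) : PermAlg (Option α) :=
  ((Fintype.card α : ℚ) + 1)⁻¹ • (((Fintype.card α : ℚ) - r) • (starSum none * optionEmb α (K r)) -
    starSum none * (starSum none * optionEmb α (K r)))

theorem arm_add_leg (K : ℕ → PermAlg α) (r : ℕ) :
    arm K r + leg K r = starSum none * optionEmb α (K r) := by
  have hN : ((Fintype.card α : ℚ) + 1) ≠ 0 := by positivity
  simp only [arm, leg]
  rw [← smul_add, inv_smul_eq_iff₀ hN]
  module

theorem starSum_none_cube (hK : HookDecomposition α K) (r : ℕ) :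
    starSum none * (starSum none * (starSum none * optionEmb α (K r))) =
      ((Fintype.card α : ℚ) - 1 - 2 * r) • (starSum none * (starSum none * optionEmb α (K r))) +
      (((Fintype.card α : ℚ) - r) * (r + 1)) • (starSum none * optionEmb α (K r)) := by
  have h2 : starSum none * (starSum none * optionEmb α (K r)) =
      (Fintype.card α : ℚ) • optionEmb α (K r) +
        ∑ j : α, permOf (swap none (some j)) * optionEmb α (starSum j * K r) := by
    rw [← mul_assoc, starSum_none_sq, add_mul, smul_mul_assoc, one_mul, Finset.sum_mul]
    simp only [mul_assoc, map_mul]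
  have h3 : starSum none * (∑ j : α, permOf (swap none (some j)) *
        optionEmb α (starSum j * K r)) =
      optionEmb α ((∑ j, starSum j) * K r) + ∑ j : α, permOf (swap none (some j)) *
        optionEmb α (starSum j * (starSum j * K r)) := by
    rw [Finset.mul_sum, Finset.sum_mul, map_sum, ← Finset.sum_add_distrib]
    refine Finset.sum_congr rfl fun j _ => ?_
    rw [← mul_assoc, starSum_none_mul_swap, add_mul, one_mul, mul_assoc, map_mul, map_mul, map_mul]
  have h4 : ∑ j : α, permOf (swap none (some j)) * optionEmb α (starSum j * (starSum j * K r)) =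
      ((Fintype.card α : ℚ) - 1 - 2 * r) • ∑ j : α, permOf (swap none (some j)) *
        optionEmb α (starSum j * K r) +
      ((r : ℚ) * (Fintype.card α - 1 - r)) • (starSum none * optionEmb α (K r)) := by
    rw [starSum_none, Finset.sum_mul, Finset.smul_sum, Finset.smul_sum, ← Finset.sum_add_distrib]
    refine Finset.sum_congr rfl fun j _ => ?_
    rw [hK.sq, map_add, map_smul, map_smul, mul_add, mul_smul_comm, mul_smul_comm]
  rw [h2, mul_add, mul_smul_comm, h3, h4, hK.total, map_smul]
  module

theorem starSum_none_mul_arm (hK : HookDecomposition α K) (r : ℕ) :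
    starSum none * arm K r = ((Fintype.card α : ℚ) - r) • arm K r := by
  simp only [arm, mul_smul_comm, mul_add, hK.starSum_none_cube]
  module

theorem starSum_none_mul_leg (hK : HookDecomposition α K) (r : ℕ) :
    starSum none * leg K r = (-((r : ℚ) + 1)) • leg K r := by
  simp only [leg, mul_smul_comm, mul_sub, hK.starSum_none_cube]
  module

theorem optionEmb_mul_arm {y : PermAlg α} {r : ℕ} {c : ℚ} (h : y * K r = c • K r) :
    optionEmb α y * arm K r = c • arm K r := by
  have hc : optionEmb α y * optionEmb α (K r) = c • optionEmb α (K r) := by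
    rw [← map_mul, h, map_smul]
  simp only [arm, mul_smul_comm, mul_add, (commute_starSum_none_optionEmb y).symm.left_comm, hc]
  module

theorem optionEmb_mul_leg {y : PermAlg α} {r : ℕ} {c : ℚ} (h : y * K r = c • K r) :
    optionEmb α y * leg K r = c • leg K r := by
  have hc : optionEmb α y * optionEmb α (K r) = c • optionEmb α (K r) := by
    rw [← map_mul, h, map_smul]
  simp only [leg, mul_smul_comm, mul_sub, (commute_starSum_none_optionEmb y).symm.left_comm, hc]
  module

theorem cycleEnum_mul_arm (hK : HookDecomposition α K) (r : ℕ) (x : ℚ) :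
    cycleEnum (Option α) x * arm K r = hookContentProd (Fintype.card α + 1) r x • arm K r := by
  rw [cycleEnum_option, mul_assoc, optionEmb_mul_arm (hK.eigen r x), mul_smul_comm, add_mul,
    hK.starSum_none_mul_arm, smul_mul_assoc, one_mul, ← add_smul, smul_smul,
    hookContentProd_mul_arm]

theorem cycleEnum_mul_leg (hK : HookDecomposition α K) (r : ℕ) (x : ℚ) :
    cycleEnum (Option α) x * leg K r =
      hookContentProd (Fintype.card α + 1) (r + 1) x • leg K r := by
  rw [cycleEnum_option, mul_assoc, optionEmb_mul_leg (hK.eigen r x), mul_smul_comm, add_mul,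
    hK.starSum_none_mul_leg, smul_mul_assoc, one_mul, ← add_smul, smul_smul, ← sub_eq_add_neg,
    hookContentProd_mul_leg]

theorem coeff_one_starSum_none_mul (y : PermAlg α) :
    (starSum none * optionEmb α y).coeff 1 = 0 := by
  rw [starSum_none, Finset.sum_mul, MonoidAlgebra.coeff_sum, Finsupp.finsetSum_apply]
  exact Finset.sum_eq_zero fun j _ => permOf_mul_optionEmb_coeff_one (by simp) y

theorem coeff_one_starSum_none_mul_mul (y : PermAlg α) :
    (starSum none * (starSum none * optionEmb α y)).coeff 1 = Fintype.card α * y.coeff 1 := by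
  rw [← mul_assoc, starSum_none_sq, add_mul, smul_mul_assoc, one_mul, Finset.sum_mul,
    MonoidAlgebra.coeff_add, Finsupp.add_apply, MonoidAlgebra.coeff_smul_apply,
    optionEmb_coeff_one, MonoidAlgebra.coeff_sum, Finsupp.finsetSum_apply,
    Finset.sum_eq_zero fun j _ => ?_, add_zero, smul_eq_mul]
  rw [mul_assoc, ← map_mul]
  exact permOf_mul_optionEmb_coeff_one (by simp) _

theorem coeff_one_arm (K : ℕ → PermAlg α) (r : ℕ) :
    (arm K r).coeff 1 = Fintype.card α / (Fintype.card α + 1) * (K r).coeff 1 := by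
  rw [arm, MonoidAlgebra.coeff_smul_apply, MonoidAlgebra.coeff_add, Finsupp.add_apply,
    MonoidAlgebra.coeff_smul_apply, coeff_one_starSum_none_mul, coeff_one_starSum_none_mul_mul]
  simp only [smul_eq_mul]
  ring

theorem coeff_one_leg (K : ℕ → PermAlg α) (r : ℕ) :
    (leg K r).coeff 1 = -(Fintype.card α / (Fintype.card α + 1) * (K r).coeff 1) := by
  have h := congrArg (fun y => y.coeff 1) (arm_add_leg K r)
  simp only [MonoidAlgebra.coeff_add, Finsupp.add_apply, coeff_one_starSum_none_mul,
    coeff_one_arm] at h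
  linarith

/-- The hook components over `Option α`: a hook with `r + 1` boxes in its leg arises from a smaller
hook by adding a box either to its arm or to its leg. -/
noncomputable def next (K : ℕ → PermAlg α) : ℕ → PermAlg (Option α)
  | 0 => arm K 0
  | r + 1 => arm K (r + 1) + leg K r

theorem sum_next (hK : HookDecomposition α K) [Nonempty α] :
    ∑ r ∈ Finset.range (Fintype.card (Option α)), next K r = longCycleSum (Option α) := by
  have harm : arm K (Fintype.card α) = 0 := by simp [arm, hK.eq_zero _ le_rfl]
  rw [Fintype.card_option, Finset.sum_range_succ', longCycleSum_option, ← hK.sum_eq, map_sum,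
    Finset.mul_sum]
  simp only [next, ← arm_add_leg, Finset.sum_add_distrib]
  have h := Finset.sum_range_succ' (arm K) (Fintype.card α)
  rw [Finset.sum_range_succ, harm, add_zero] at h
  rw [h]
  abel

theorem sum_starSum_mul_arm (hK : HookDecomposition α K) (r : ℕ) :
    (∑ y : Option α, starSum y) * arm K r =
      (((Fintype.card α : ℚ) + 1) * (Fintype.card α - 2 * r)) • arm K r := by
  rw [sum_starSum_option, add_mul, optionEmb_mul_arm (hK.total r), smul_mul_assoc,
    hK.starSum_none_mul_arm]
  module

theorem sum_starSum_mul_leg (hK : HookDecomposition α K) (r : ℕ) :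
    (∑ y : Option α, starSum y) * leg K r =
      (((Fintype.card α : ℚ) + 1) * (Fintype.card α - 2 * (r + 1))) • leg K r := by
  rw [sum_starSum_option, add_mul, optionEmb_mul_leg (hK.total r), smul_mul_assoc,
    hK.starSum_none_mul_leg]
  module

theorem sum_starSum_mul_next (hK : HookDecomposition α K) (r : ℕ) :
    (∑ y : Option α, starSum y) * next K r =
      ((Fintype.card (Option α) : ℚ) * ((Fintype.card (Option α) : ℚ) - 1 - 2 * r)) •
        next K r := by
  rw [Fintype.card_option]
  rcases r with _ | r
  · simp only [next, hK.sum_starSum_mul_arm]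
    push_cast
    module
  · simp only [next, mul_add, hK.sum_starSum_mul_arm, hK.sum_starSum_mul_leg]
    push_cast
    module

theorem next_eq_zero (hK : HookDecomposition α K) (r : ℕ) (hr : Fintype.card (Option α) ≤ r) :
    next K r = 0 := by
  rw [Fintype.card_option] at hr
  obtain ⟨s, rfl⟩ : ∃ s, r = s + 1 := ⟨r - 1, by omega⟩
  simp [next, arm, leg, hK.eq_zero s (by omega), hK.eq_zero (s + 1) (by omega)]

theorem commute_next (hK : HookDecomposition α K) [Nonempty α] (r : ℕ) (g : Perm (Option α)) :
    Commute (permOf g) (next K r) := by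
  rcases le_or_gt (Fintype.card (Option α)) r with hr | hr
  · simp only [hK.next_eq_zero r hr, Commute.zero_right]
  set D : PermAlg (Option α) := ∑ y : Option α, starSum y
  set M := Fintype.card (Option α) with hM
  have hM0 : (M : ℚ) ≠ 0 := by rw [hM, Fintype.card_option]; positivity
  set μ : ℕ → ℚ := fun s => (M : ℚ) * ((M : ℚ) - 1 - 2 * s)
  have hμ : Function.Injective μ := fun s t h => by
    have : (s : ℚ) = t := by linarith [mul_left_cancel₀ hM0 h]
    exact_mod_cast this
  -- `D` is central, so both sides lie in the eigenspace of `D` that belongs to `μ s`.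
  have hindep := (Module.End.eigenspaces_iSupIndep (LinearMap.mulLeft ℚ D)).comp hμ
  have hleft : ∀ s,
      permOf g * next K s ∈ Module.End.eigenspace (LinearMap.mulLeft ℚ D) (μ s) := fun s => by
    rw [Module.End.mem_eigenspace_iff, LinearMap.mulLeft_apply,
      (commute_sum_starSum g).symm.left_comm, hK.sum_starSum_mul_next, mul_smul_comm]
  have hright : ∀ s,
      next K s * permOf g ∈ Module.End.eigenspace (LinearMap.mulLeft ℚ D) (μ s) := fun s => by
    rw [Module.End.mem_eigenspace_iff, LinearMap.mulLeft_apply, ← mul_assoc,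
      hK.sum_starSum_mul_next, smul_mul_assoc]
  have hsum : ∑ s ∈ Finset.range M, permOf g * next K s =
      ∑ s ∈ Finset.range M, next K s * permOf g := by
    rw [← Finset.mul_sum, ← Finset.sum_mul, hK.sum_next, (commute_longCycleSum g).eq]
  exact (iSupIndep_iff_finsetSum_eq_imp_eq _).1 hindep _ _ _
    (fun s _ => ⟨hleft s, hright s⟩) hsum r (Finset.mem_range.2 hr)

theorem next_sq_none (hK : HookDecomposition α K) (r : ℕ) :
    starSum none * (starSum none * next K r) =
      ((Fintype.card (Option α) : ℚ) - 1 - 2 * r) • (starSum none * next K r) +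
        ((r : ℚ) * (Fintype.card (Option α) - 1 - r)) • next K r := by
  rw [Fintype.card_option]
  rcases r with _ | r
  · simp only [next, hK.starSum_none_mul_arm, mul_smul_comm]
    push_cast
    module
  · simp only [next, hK.starSum_none_mul_arm, hK.starSum_none_mul_leg, mul_smul_comm, mul_add]
    push_cast
    module

theorem next_sq (hK : HookDecomposition α K) [Nonempty α] (r : ℕ) (y : Option α) :
    starSum y * (starSum y * next K r) =
      ((Fintype.card (Option α) : ℚ) - 1 - 2 * r) • (starSum y * next K r) +
        ((r : ℚ) * (Fintype.card (Option α) - 1 - r)) • next K r := by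
  set g : Perm (Option α) := swap none y with hg
  have hgy : starSum y * permOf g = permOf g * starSum none := by
    rw [permOf_mul_starSum, hg, swap_apply_left]
  have hcancel : ∀ v w : PermAlg (Option α), v * permOf g = w * permOf g → v = w := by
    intro v w h
    have := congrArg (· * permOf g) h
    simpa [mul_assoc, ← permOf_mul, hg, MonoidAlgebra.one_def.symm] using this
  apply hcancel
  simp only [add_mul, smul_mul_assoc, mul_assoc, ← (hK.commute_next r g).eq]
  simp only [← mul_assoc, hgy]
  simp only [mul_assoc]
  rw [hK.next_sq_none, mul_add, mul_smul_comm, mul_smul_comm]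

theorem cycleEnum_mul_next (hK : HookDecomposition α K) (r : ℕ) (x : ℚ) :
    cycleEnum (Option α) x * next K r =
      hookContentProd (Fintype.card (Option α)) r x • next K r := by
  rw [Fintype.card_option]
  rcases r with _ | r
  · exact hK.cycleEnum_mul_arm 0 x
  · rw [next, mul_add, hK.cycleEnum_mul_arm, hK.cycleEnum_mul_leg, smul_add, Nat.cast_succ]

theorem coeff_one_next (hK : HookDecomposition α K) [Nonempty α] (r : ℕ) :
    (next K r).coeff 1 = (-1) ^ r * ((Fintype.card (Option α) - 1).choose r : ℚ) /
      Fintype.card (Option α) := by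
  obtain ⟨m, hm⟩ : ∃ m, Fintype.card α = m + 1 :=
    ⟨Fintype.card α - 1, by have := Fintype.card_pos (α := α); omega⟩
  have hm1 : ((m : ℚ) + 1) ≠ 0 := by positivity
  have hm2 : ((m : ℚ) + 1 + 1) ≠ 0 := by positivity
  rw [Fintype.card_option]
  rcases r with _ | r
  · rw [next, coeff_one_arm, hK.coeff_one, hm]
    simp only [Nat.cast_add, Nat.cast_one, pow_zero, Nat.add_sub_cancel, Nat.choose_zero_right,
      mul_one, one_div]
    field_simp
  · rw [next, MonoidAlgebra.coeff_add, Finsupp.add_apply, coeff_one_arm, coeff_one_leg,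
      hK.coeff_one, hK.coeff_one, hm]
    simp only [Nat.add_sub_cancel, Nat.choose_succ_succ]
    push_cast
    field_simp
    ring

theorem next_spec (hK : HookDecomposition α K) [Nonempty α] :
    HookDecomposition (Option α) (next K) :=
  ⟨hK.sum_next, hK.next_eq_zero, hK.next_sq, hK.cycleEnum_mul_next, hK.sum_starSum_mul_next,
    hK.coeff_one_next⟩

theorem unit : HookDecomposition Unit (fun r => if r = 0 then 1 else 0) := by
  have hstar : ∀ j : Unit, starSum j = 0 := fun j => by simp [starSum]
  have hcount : ∀ π : Perm Unit, cycleCount π = 1 := fun π => by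
    have : Subsingleton (CycleSet π) := (CycleSet.mk_surjective π).subsingleton
    have : Nonempty (CycleSet π) := ⟨CycleSet.mk π ()⟩
    exact Nat.card_unique
  have hcycleEnum : ∀ x, cycleEnum Unit x = x • 1 := fun x => by
    simp [cycleEnum, hcount, MonoidAlgebra.one_def]
  refine ⟨?_, fun r hr => if_neg (by simp at hr; omega), fun r j => ?_, fun r x => ?_,
    fun r => ?_, fun r => ?_⟩
  · simp [longCycleSum, hcount, MonoidAlgebra.one_def]
  all_goals rcases r with _ | r
  all_goals simp [hstar, hcycleEnum, hookContentProd]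

end HookDecomposition

/-! ### Factorizations of a cycle with one fixed point -/

/-- The type with `m + 1` elements obtained from `Unit` by adding `m` points one at a time. -/
def IterOption : ℕ → Type
  | 0 => Unit
  | m + 1 => Option (IterOption m)

namespace IterOption

instance instFintype : ∀ m, Fintype (IterOption m)
  | 0 => inferInstanceAs (Fintype Unit)
  | m + 1 => letI := instFintype m; inferInstanceAs (Fintype (Option (IterOption m)))

instance instDecidableEq : ∀ m, DecidableEq (IterOption m)
  | 0 => inferInstanceAs (DecidableEq Unit)
  | m + 1 => letI := instDecidableEq m; inferInstanceAs (DecidableEq (Option (IterOption m)))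

instance instNonempty : ∀ m, Nonempty (IterOption m)
  | 0 => inferInstanceAs (Nonempty Unit)
  | m + 1 => inferInstanceAs (Nonempty (Option (IterOption m)))

theorem card (m : ℕ) : Fintype.card (IterOption m) = m + 1 := by
  induction m with
  | zero => exact Fintype.card_unit
  | succ m ih => exact (Fintype.card_option (α := IterOption m)).trans (by rw [ih])

theorem exists_hookDecomposition (m : ℕ) : ∃ K, HookDecomposition (IterOption m) K := by
  induction m with
  | zero => exact ⟨_, HookDecomposition.unit⟩
  | succ m ih =>
    obtain ⟨K, hK⟩ := ih
    exact ⟨_, hK.next_spec⟩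

theorem card_longCycles (m : ℕ) : #{π : Perm (IterOption m) | cycleCount π = 1} = m ! := by
  induction m with
  | zero =>
    have : Unique (IterOption 0) := inferInstanceAs (Unique Unit)
    have hcount : ∀ π : Perm (IterOption 0), cycleCount π = 1 := fun π => by
      have : Subsingleton (CycleSet π) := (CycleSet.mk_surjective π).subsingleton
      have : Nonempty (CycleSet π) := ⟨CycleSet.mk π default⟩
      exact Nat.card_unique
    rw [Finset.filter_true_of_mem fun π _ => hcount π, Finset.card_univ, Fintype.card_perm, card]
    rfl
  | succ m ih =>
    rw [Nat.factorial_succ, ← ih]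
    exact card_longCycles_option.trans (by rw [card])

end IterOption

section Factorizations

variable {α : Type*}

theorem prod_ofFn_sum_coeff [Fintype α] [DecidableEq α] {k : ℕ} (w : Fin k → Perm α → ℚ)
    (g : Perm α) :
    (List.ofFn fun i => ∑ π, w i π • permOf π).prod.coeff g =
      ∑ π : Fin k → Perm α, if (List.ofFn π).prod = g then ∏ i, w i (π i) else 0 := by
  have hexpand : (List.ofFn fun i => ∑ π, w i π • permOf π).prod =
      ∑ π : Fin k → Perm α, (∏ i, w i (π i)) • permOf (List.ofFn π).prod := by
    have h := (MultilinearMap.mkPiAlgebraFin ℚ k (PermAlg α)).map_sum (fun i π => w i π • permOf π)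
    simp only [MultilinearMap.map_smul_univ, MultilinearMap.mkPiAlgebraFin_apply] at h
    simp only [h, permOf, map_list_prod, List.map_ofFn]
    rfl
  rw [hexpand, MonoidAlgebra.coeff_sum, Finsupp.finsetSum_apply]
  refine Finset.sum_congr rfl fun π _ => ?_
  simp [permOf, Finsupp.single_apply]

theorem prod_ofFn_mul_of_eigen {R A : Type*} [CommSemiring R] [Semiring A] [Algebra R A] {k : ℕ}
    {a : Fin k → A} {c : Fin k → R} {v : A} (h : ∀ i, a i * v = c i • v) :
    (List.ofFn a).prod * v = (∏ i, c i) • v := by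
  induction k with
  | zero => simp
  | succ k ih =>
    rw [List.ofFn_succ, List.prod_cons, mul_assoc, ih (fun i => h i.succ), mul_smul_comm, h,
      smul_smul, Fin.prod_univ_succ, mul_comm]

theorem commute_prod_ofFn {M : Type*} [Monoid M] {k : ℕ} {a : Fin k → M} {v : M}
    (h : ∀ i, Commute v (a i)) : Commute v (List.ofFn a).prod :=
  Commute.list_prod_right _ _ fun b hb => by
    obtain ⟨i, rfl⟩ := (List.mem_ofFn' _ _).1 hb
    exact h i

theorem cycleCount_eq_one_iff [Nonempty α] {π : Perm α} :
    cycleCount π = 1 ↔ ∀ x y, π.SameCycle x y := by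
  have : Nonempty (CycleSet π) := (inferInstance : Nonempty α).map (CycleSet.mk π)
  rw [cycleCount, Nat.card_eq_one_iff_unique, and_iff_left this]
  refine ⟨fun _ x y => CycleSet.mk_eq_mk.1 (Subsingleton.elim _ _), fun h => ⟨fun C D => ?_⟩⟩
  obtain ⟨x, rfl⟩ := CycleSet.mk_surjective π C
  obtain ⟨y, rfl⟩ := CycleSet.mk_surjective π D
  exact CycleSet.mk_eq_mk.2 (h x y)

theorem isConj_of_cycleCount_eq_one [Finite α] {σ τ : Perm α} (hσ : cycleCount σ = 1)
    (hτ : cycleCount τ = 1) : IsConj σ τ := by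
  classical
  have := Fintype.ofFinite α
  rcases subsingleton_or_nontrivial α with hα | hα
  · rw [Subsingleton.elim σ τ]
  have key : ∀ ρ : Perm α, cycleCount ρ = 1 → ρ.IsCycle ∧ ρ.support = Finset.univ := by
    intro ρ hρ
    have hsame := cycleCount_eq_one_iff.1 hρ
    have hmove : ∀ x, ρ x ≠ x := fun x hx => by
      obtain ⟨y, hy⟩ := exists_ne x
      exact hy ((hsame x y).eq_of_left hx).symm
    obtain ⟨x⟩ := (inferInstance : Nonempty α)
    exact ⟨⟨x, hmove x, fun y _ => hsame x y⟩, by ext y; simp [hmove y]⟩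
  rw [(key σ hσ).1.isConj_iff (key τ hτ).1, (key σ hσ).2, (key τ hτ).2]

theorem coeff_conj_eq {y : PermAlg (Option α)} {g : Perm α}
    (hy : Commute (permOf (optionCongr g)) y) (h : Perm α) :
    y.coeff (optionCongr (g * h * g⁻¹)) = y.coeff (optionCongr h) := by
  have hgh := congrArg (fun z => z.coeff (optionCongr g * optionCongr h)) hy.eq
  simp only [permOf, MonoidAlgebra.of_apply, MonoidAlgebra.coeff_mul_single_apply,
    MonoidAlgebra.coeff_single_mul_apply, one_mul, mul_one, inv_mul_cancel_left] at hgh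
  rw [hgh]
  simp only [← optionCongrHom_apply, map_mul, map_inv]

theorem coeff_one_mul_longCycleSum [Fintype α] [DecidableEq α] {y : PermAlg (Option α)}
    (hy : ∀ g : Perm α, Commute (permOf (optionCongr g)) y) {σ : Perm α} (hσ : cycleCount σ = 1) :
    (y * optionEmb α (longCycleSum α)).coeff 1 =
      #{π : Perm α | cycleCount π = 1} * y.coeff (optionCongr σ) := by
  have hcoeff : ∀ π : Perm α, cycleCount π = 1 →
      (y * permOf (optionCongr π)).coeff 1 = y.coeff (optionCongr σ) := fun π hπ => by
    obtain ⟨g, hg⟩ := isConj_iff.1 (isConj_of_cycleCount_eq_one hσ ((cycleCount_inv π).trans hπ))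
    rw [← coeff_conj_eq (hy g) σ, hg, ← optionCongrHom_apply π⁻¹, map_inv]
    simp [permOf, MonoidAlgebra.coeff_mul_single_apply]
  rw [longCycleSum, map_sum, Finset.mul_sum, MonoidAlgebra.coeff_sum, Finsupp.finsetSum_apply]
  simp only [optionEmb_permOf]
  rw [Finset.sum_congr rfl fun π hπ => hcoeff π (Finset.mem_filter.1 hπ).2, Finset.sum_const,
    nsmul_eq_mul]

end Factorizations

namespace HookDecomposition

variable {α : Type*} [Fintype α] [DecidableEq α] {K : ℕ → PermAlg α}

/-- The component of `K r` in the shape obtained by adding a box of content zero to the hook. -/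
noncomputable def corner (K : ℕ → PermAlg α) (r : ℕ) : PermAlg (Option α) :=
  optionEmb α (K r) - ((Fintype.card α : ℚ) - r)⁻¹ • arm K r + ((r : ℚ) + 1)⁻¹ • leg K r

theorem optionEmb_eq (K : ℕ → PermAlg α) (r : ℕ) : optionEmb α (K r) =
    ((Fintype.card α : ℚ) - r)⁻¹ • arm K r - ((r : ℚ) + 1)⁻¹ • leg K r + corner K r := by
  rw [corner]
  abel

theorem starSum_none_mul_corner (hK : HookDecomposition α K) {r : ℕ} (hr : r < Fintype.card α) :
    starSum none * corner K r = 0 := by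
  have harm : ((Fintype.card α : ℚ) - r) ≠ 0 := sub_ne_zero.2 (by exact_mod_cast hr.ne')
  have hleg : ((r : ℚ) + 1) ≠ 0 := by positivity
  rw [corner, mul_add, mul_sub, mul_smul_comm, mul_smul_comm, hK.starSum_none_mul_arm,
    hK.starSum_none_mul_leg, smul_smul, smul_smul, inv_mul_cancel₀ harm, mul_neg,
    inv_mul_cancel₀ hleg, ← arm_add_leg]
  module

theorem cycleEnum_mul_corner (hK : HookDecomposition α K) {r : ℕ} (hr : r < Fintype.card α)
    (x : ℚ) : cycleEnum (Option α) x * corner K r =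
      (x * hookContentProd (Fintype.card α) r x) • corner K r := by
  have h : optionEmb α (cycleEnum α x) * corner K r =
      hookContentProd (Fintype.card α) r x • corner K r := by
    rw [corner, mul_add, mul_sub, mul_smul_comm, mul_smul_comm,
      optionEmb_mul_arm (hK.eigen r x), optionEmb_mul_leg (hK.eigen r x), ← map_mul, hK.eigen,
      map_smul]
    module
  rw [cycleEnum_option, mul_assoc, h, mul_smul_comm, add_mul, hK.starSum_none_mul_corner hr,
    smul_mul_assoc, one_mul, add_zero, smul_smul, mul_comm]

theorem coeff_one_mul_sub_of_eigen (hK : HookDecomposition α K) {r : ℕ} (hr : r < Fintype.card α)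
    {y z : PermAlg (Option α)} {a b c : ℚ} (harm : y * arm K r = a • arm K r)
    (hleg : y * leg K r = b • leg K r) (hcorner : y * corner K r = c • corner K r)
    (hz : z * optionEmb α (K r) = c • optionEmb α (K r)) :
    (Fintype.card α * (Fintype.card α + 1) : ℚ) *
      ((y * optionEmb α (K r)).coeff 1 - (z * optionEmb α (K r)).coeff 1) =
      (-1) ^ r * ((Fintype.card α).choose r * (a - c) +
        (Fintype.card α).choose (r + 1) * (b - c)) := by
  have hdiff : y * optionEmb α (K r) - z * optionEmb α (K r) =
      ((Fintype.card α - r : ℚ)⁻¹ * (a - c)) • arm K r -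
        ((r + 1 : ℚ)⁻¹ * (b - c)) • leg K r := by
    rw [hz, optionEmb_eq, mul_add, mul_sub, mul_smul_comm, mul_smul_comm, harm, hleg, hcorner]
    module
  rw [← Finsupp.sub_apply, ← MonoidAlgebra.coeff_sub, hdiff]
  simp only [MonoidAlgebra.coeff_sub, MonoidAlgebra.coeff_smul, Finsupp.sub_apply,
    Finsupp.smul_apply, smul_eq_mul, coeff_one_arm, coeff_one_leg, hK.coeff_one]
  obtain ⟨m, hm⟩ : ∃ m, Fintype.card α = m + 1 := ⟨Fintype.card α - 1, by omega⟩
  rw [hm] at hr ⊢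
  have hmr : ((m : ℚ) + 1 - r) ≠ 0 := sub_ne_zero.2 (by exact_mod_cast hr.ne')
  have hr1 : ((r : ℚ) + 1) ≠ 0 := by positivity
  have hm1 : ((m : ℚ) + 1) ≠ 0 := by positivity
  have hm2 : ((m : ℚ) + 1 + 1) ≠ 0 := by positivity
  have hchoose : ((m + 1).choose r : ℚ) = (m + 1) / (m + 1 - r) * m.choose r := by
    have h : (m.choose r : ℚ) * (m + 1 : ℕ) = (m + 1).choose r * (m + 1 - r : ℕ) := by
      exact_mod_cast Nat.choose_mul_succ_eq m r
    rw [Nat.cast_sub hr.le] at h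
    push_cast at h
    rw [div_mul_eq_mul_div, eq_div_iff hmr]
    linarith
  have hchoose_succ : ((m + 1).choose (r + 1) : ℚ) = (m + 1) / (r + 1) * m.choose r := by
    rw [div_mul_eq_mul_div, eq_div_iff hr1]
    exact_mod_cast (Nat.add_one_mul_choose_eq m r).symm
  rw [hchoose, hchoose_succ, Nat.add_sub_cancel]
  push_cast
  field_simp
  ring

end HookDecomposition

theorem sum_alternating_choose {R : Type*} [CommRing R] (N : ℕ) {a b : ℕ → R} (h0 : a 0 = b 0)
    (hN : a N = b (N + 1)) :
    ∑ r ∈ Finset.range N, (-1) ^ r * (N.choose r * (a r - b (r + 1)) +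
        N.choose (r + 1) * (a (r + 1) - b (r + 1))) =
      ∑ t ∈ Finset.range (N + 2), (-1) ^ t * (N + 1).choose t * b t := by
  have htel := Finset.sum_range_sub' (fun r => (-1) ^ r * (N.choose r : R) * a r) N
  simp only [pow_zero, Nat.choose_zero_right, Nat.choose_self, Nat.cast_one, h0, hN] at htel
  have hterm : ∀ r, (-1) ^ r * (N.choose r * (a r - b (r + 1)) +
      N.choose (r + 1) * (a (r + 1) - b (r + 1))) =
      ((-1) ^ r * N.choose r * a r - (-1) ^ (r + 1) * N.choose (r + 1) * a (r + 1)) +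
        (-1) ^ (r + 1) * (N + 1).choose (r + 1) * b (r + 1) := fun r => by
    rw [Nat.choose_succ_succ]
    push_cast
    ring
  simp only [hterm, Finset.sum_add_distrib, htel]
  rw [Finset.sum_range_succ, Finset.sum_range_succ']
  simp only [pow_zero, Nat.choose_zero_right, Nat.choose_self, Nat.cast_one]
  ring

theorem sum_perm_fixing_none {α : Type*} [Fintype α] [DecidableEq α] (x : ℚ) :
    ∑ π : Perm (Option α), (if π none = none then x ^ cycleCount π else 0) • permOf π =
      x • optionEmb α (cycleEnum α x) := by
  rw [sum_perm_option, cycleEnum, map_sum, Finset.smul_sum]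
  refine Finset.sum_congr rfl fun τ _ => ?_
  rw [Finset.sum_eq_zero fun j _ => by simp, map_smul, optionEmb_permOf, smul_smul,
    cycleCount_optionCongr, pow_succ']
  simp

theorem sum_factorizations_not_fixing_none {α : Type*} [Fintype α] [DecidableEq α] {k : ℕ}
    (x : Fin k → ℚ) (g : Perm (Option α)) :
    ∑ π : Fin k → Perm (Option α) with (List.ofFn π).prod = g ∧ ¬ ∀ i, π i none = none,
        ∏ i, x i ^ cycleCount (π i) =
      (List.ofFn fun i => cycleEnum (Option α) (x i)).prod.coeff g -
        (List.ofFn fun i => x i • optionEmb α (cycleEnum α (x i))).prod.coeff g := by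
  simp only [← sum_perm_fixing_none]
  simp only [cycleEnum]
  rw [prod_ofFn_sum_coeff, prod_ofFn_sum_coeff, ← Finset.sum_sub_distrib, Finset.sum_filter]
  refine Finset.sum_congr rfl fun π _ => ?_
  rw [Finset.prod_ite_zero]
  by_cases hp : (List.ofFn π).prod = g <;> by_cases hf : ∀ i, π i none = none <;> simp [hp, hf]

namespace HookDecomposition

variable {α : Type*} [Fintype α] [DecidableEq α] {K : ℕ → PermAlg α}

theorem coeff_one_prod_sub (hK : HookDecomposition α K) {r : ℕ} (hr : r < Fintype.card α)
    {k : ℕ} (x : Fin k → ℚ) :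
    (Fintype.card α * (Fintype.card α + 1) : ℚ) *
      (((List.ofFn fun i => cycleEnum (Option α) (x i)).prod * optionEmb α (K r)).coeff 1 -
        ((List.ofFn fun i => x i • optionEmb α (cycleEnum α (x i))).prod *
          optionEmb α (K r)).coeff 1) =
      (-1) ^ r *
        ((Fintype.card α).choose r * (∏ i, hookContentProd (Fintype.card α + 1) r (x i) -
          ∏ i, (x i * hookContentProd (Fintype.card α) r (x i))) +
        (Fintype.card α).choose (r + 1) *
          (∏ i, hookContentProd (Fintype.card α + 1) (r + 1) (x i) -
            ∏ i, (x i * hookContentProd (Fintype.card α) r (x i)))) :=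
  hK.coeff_one_mul_sub_of_eigen hr
    (prod_ofFn_mul_of_eigen fun i => hK.cycleEnum_mul_arm r (x i))
    (prod_ofFn_mul_of_eigen fun i => hK.cycleEnum_mul_leg r (x i))
    (prod_ofFn_mul_of_eigen fun i => hK.cycleEnum_mul_corner hr (x i))
    (prod_ofFn_mul_of_eigen fun i => by
      rw [smul_mul_assoc, ← map_mul, hK.eigen, map_smul, smul_smul])

theorem sum_factorizations (hK : HookDecomposition α K) {σ : Perm α} (hσ : cycleCount σ = 1)
    {k : ℕ} (x : Fin k → ℚ) :
    (#{π : Perm α | cycleCount π = 1} : ℚ) * (Fintype.card α * (Fintype.card α + 1)) *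
      ∑ π : Fin k → Perm (Option α) with
        (List.ofFn π).prod = optionCongr σ ∧ ¬ ∀ i, π i none = none,
        ∏ i, x i ^ cycleCount (π i) =
      ∑ t ∈ Finset.range (Fintype.card α + 2), (-1) ^ t * (Fintype.card α + 1).choose t *
        ∏ i, (x i * hookContentProd (Fintype.card α) (t - 1) (x i)) := by
  have hsum : ∀ y : PermAlg (Option α), (y * optionEmb α (longCycleSum α)).coeff 1 =
      ∑ r ∈ Finset.range (Fintype.card α), (y * optionEmb α (K r)).coeff 1 := fun y => by
    rw [← hK.sum_eq, map_sum, Finset.mul_sum, MonoidAlgebra.coeff_sum, Finsupp.finsetSum_apply]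
  have hcommute : ∀ g : Perm α, Commute (permOf (optionCongr g))
      (List.ofFn fun i => cycleEnum (Option α) (x i)).prod := fun g =>
    commute_prod_ofFn fun i => commute_cycleEnum _ _
  have hcommute' : ∀ g : Perm α, Commute (permOf (optionCongr g))
      (List.ofFn fun i => x i • optionEmb α (cycleEnum α (x i))).prod := fun g =>
    commute_prod_ofFn fun i => by
      rw [← optionEmb_permOf]
      exact ((commute_cycleEnum (x i) g).map (optionEmb α)).smul_right _
  rw [sum_factorizations_not_fixing_none, mul_right_comm, mul_sub,
    ← coeff_one_mul_longCycleSum hcommute hσ, ← coeff_one_mul_longCycleSum hcommute' hσ, hsum, hsum,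
    ← Finset.sum_sub_distrib, mul_comm, Finset.mul_sum,
    ← sum_alternating_choose (Fintype.card α)
      (a := fun r => ∏ i, hookContentProd (Fintype.card α + 1) r (x i))]
  · refine Finset.sum_congr rfl fun r hr => ?_
    rw [hK.coeff_one_prod_sub (Finset.mem_range.1 hr)]
    push_cast
    simp only [add_sub_cancel_right]
  · refine Finset.prod_congr rfl fun i _ => ?_
    simpa [mul_comm] using (hookContentProd_mul_leg (Fintype.card α) (-1) (x i)).symm
  · refine Finset.prod_congr rfl fun i _ => ?_
    simpa [mul_comm] using
      (hookContentProd_mul_arm (Fintype.card α) (Fintype.card α) (x i)).symm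

end HookDecomposition

/-- The group elements `u i` multiply to `g` and generate a group that acts transitively on `X`. -/
def IsTransitiveFactorization {G : Type*} [Group G] (X : Type*) [MulAction G X] {k : ℕ}
    (u : Fin k → G) (g : G) : Prop :=
  (List.ofFn u).prod = g ∧ MulAction.IsPretransitive (Subgroup.closure (Set.range u)) X

noncomputable instance {G : Type*} [Group G] (X : Type*) [MulAction G X] {k : ℕ}
    (u : Fin k → G) (g : G) : Decidable (IsTransitiveFactorization X u g) := Classical.dec _

theorem prod_ofFn_mem_closure {G : Type*} [Group G] {k : ℕ} (u : Fin k → G) :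
    (List.ofFn u).prod ∈ Subgroup.closure (Set.range u) := by
  refine Subgroup.list_prod_mem _ fun g hg => ?_
  obtain ⟨i, rfl⟩ := (List.mem_ofFn' _ _).1 hg
  exact Subgroup.subset_closure ⟨i, rfl⟩

section FixedPoint

variable {X : Type*} [Nontrivial X] {ς : Perm X} {b : X} {k : ℕ} {π : Fin k → Perm X}

theorem isPretransitive_closure_iff (hς : ∀ x y, x ≠ b → y ≠ b → ς.SameCycle x y)
    (hprod : (List.ofFn π).prod = ς) :
    MulAction.IsPretransitive (Subgroup.closure (Set.range π)) X ↔ ¬ ∀ i, π i b = b := by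
  constructor
  · intro h hfix
    obtain ⟨y, hy⟩ := exists_ne b
    obtain ⟨g, hg⟩ := h.exists_smul_eq b y
    have hle : Subgroup.closure (Set.range π) ≤ MulAction.stabilizer (Perm X) b := by
      rw [Subgroup.closure_le]
      rintro _ ⟨i, rfl⟩
      exact hfix i
    exact hy (hg.symm.trans (hle g.2))
  · intro h
    obtain ⟨i, hi⟩ := not_forall.1 h
    have hςmem : ς ∈ Subgroup.closure (Set.range π) := hprod ▸ prod_ofFn_mem_closure π
    rw [MulAction.isPretransitive_iff_base b]
    intro y
    by_cases hy : y = b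
    · exact ⟨1, by simp [hy]⟩
    · obtain ⟨m, hm⟩ := hς (π i b) y hi hy
      exact ⟨⟨ς ^ m * π i, mul_mem (zpow_mem hςmem m) (Subgroup.subset_closure ⟨i, rfl⟩)⟩, hm⟩

theorem isTransitiveFactorization_iff (hς : ∀ x y, x ≠ b → y ≠ b → ς.SameCycle x y) :
    IsTransitiveFactorization X π ς ↔ (List.ofFn π).prod = ς ∧ ¬ ∀ i, π i b = b :=
  and_congr_right (isPretransitive_closure_iff hς)

end FixedPoint

theorem cycleCount_permCongr {X Y : Type*} (e : X ≃ Y) (π : Perm X) :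
    cycleCount (e.permCongr π) = cycleCount π :=
  (cycleCount_eq_of_semiconj e fun x => by simp).symm

theorem exists_optionCongr_eq_permCongr {X α : Type*} [Nonempty α] (e : X ≃ Option α)
    {ς : Perm X} (hfix : ς (e.symm none) = e.symm none)
    (hς : ∀ x y, x ≠ e.symm none → y ≠ e.symm none → ς.SameCycle x y) :
    ∃ σ : Perm α, optionCongr σ = e.permCongr ς ∧ cycleCount σ = 1 := by
  classical
  have hσ : optionCongr (removeNone (e.permCongr ς)) = e.permCongr ς := by
    rw [map_equiv_removeNone, permCongr_apply, hfix, e.apply_symm_apply, swap_self]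
    rfl
  refine ⟨removeNone (e.permCongr ς), hσ, cycleCount_eq_one_iff.2 fun x y => ?_⟩
  obtain ⟨l, hl⟩ := hς (e.symm (some x)) (e.symm (some y)) (by simp) (by simp)
  refine ⟨l, Option.some_injective _ ?_⟩
  calc some ((removeNone (e.permCongr ς) ^ l) x)
      = optionCongrHom α (removeNone (e.permCongr ς) ^ l) (some x) := rfl
    _ = e.permCongrHom (ς ^ l) (some x) := by
      rw [map_zpow, optionCongrHom_apply, hσ, map_zpow]
      rfl
    _ = some y := by simp [permCongrHom, hl]

theorem sum_transitive_factorizations {X : Type*} [Fintype X] [DecidableEq X] [Nontrivial X]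
    {ς : Perm X} {b : X} (hb : ς b = b) (hς : ∀ x y, x ≠ b → y ≠ b → ς.SameCycle x y) {k : ℕ}
    (x : Fin k → ℚ) :
    ((Fintype.card X) ! : ℚ) *
      ∑ π : Fin k → Perm X with IsTransitiveFactorization X π ς, ∏ i, x i ^ cycleCount (π i) =
      ∑ t ∈ Finset.range (Fintype.card X + 1), (-1) ^ t * (Fintype.card X).choose t *
        ∏ i, (x i * hookContentProd (Fintype.card X - 1) (t - 1) (x i)) := by
  obtain ⟨m, hm⟩ : ∃ m, Fintype.card X = m + 2 :=
    ⟨Fintype.card X - 2, by have := Fintype.one_lt_card (α := X); omega⟩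
  obtain ⟨e, rfl⟩ : ∃ e : X ≃ Option (IterOption m), e.symm none = b := by
    have e := Fintype.equivOfCardEq (α := X) (β := Option (IterOption m))
      (by rw [Fintype.card_option, IterOption.card, hm])
    exact ⟨e.trans (swap (e b) none), by simp⟩
  obtain ⟨σ, hσ, hσ1⟩ := exists_optionCongr_eq_permCongr e hb hς
  obtain ⟨K, hK⟩ := IterOption.exists_hookDecomposition m
  have hoption := hK.sum_factorizations hσ1 x
  rw [IterOption.card_longCycles, IterOption.card] at hoption
  have hfact : ((m + 2)! : ℚ) = m ! * ((m + 1 : ℕ) * ((m + 1 : ℕ) + 1)) := by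
    rw [Nat.factorial_succ, Nat.factorial_succ]
    push_cast
    ring
  rw [hm, hfact]
  refine Eq.trans ?_ hoption
  congr 1
  refine Finset.sum_equiv (Equiv.piCongrRight fun _ => e.permCongr) (fun π => ?_) fun π _ => ?_
  · have hprod : (List.ofFn fun i => e.permCongr (π i)).prod = e.permCongr (List.ofFn π).prod := by
      rw [← permCongrHom_coe, map_list_prod, List.map_ofFn]
      rfl
    have hfixes : (∀ i, e.permCongr (π i) none = none) ↔ ∀ i, π i (e.symm none) = e.symm none :=
      forall_congr' fun i => by rw [permCongr_apply, ← e.eq_symm_apply]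
    simp only [Finset.mem_filter, Finset.mem_univ, true_and, isTransitiveFactorization_iff hς]
    change _ ↔ (List.ofFn fun i => e.permCongr (π i)).prod = _ ∧
      ¬ ∀ i, e.permCongr (π i) none = none
    rw [hprod, hσ, e.permCongr.injective.eq_iff, hfixes]
  · simp only [piCongrRight_apply, Pi.map_apply, cycleCount_permCongr]

/-! ### Fixed spaces of generalized permutation matrices -/

section CycleWeight

variable {α A : Type*} [Fintype α] [AddCommGroup A]

/-- The sums of a weight function over the cycles of a permutation. -/
noncomputable def cycleWeight (π : Perm α) : (α → A) →+ (CycleSet π → A) where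
  toFun a C := ∑ j with CycleSet.mk π j = C, a j
  map_zero' := by ext C; simp
  map_add' a b := by ext C; simp [Finset.sum_add_distrib]

theorem cycleWeight_apply (π : Perm α) (a : α → A) (C : CycleSet π) :
    cycleWeight π a C = ∑ j with CycleSet.mk π j = C, a j := rfl

theorem cycleWeight_single [DecidableEq α] (π : Perm α) (j : α) (t : A) :
    cycleWeight π (Pi.single j t) = Pi.single (CycleSet.mk π j) t := by
  ext C
  simp [cycleWeight_apply, Pi.single_apply, eq_comm]

theorem sum_cycleWeight (π : Perm α) (a : α → A) : ∑ C, cycleWeight π a C = ∑ j, a j :=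
  Finset.sum_fiberwise Finset.univ (CycleSet.mk π) a

theorem exists_potential (π : Perm α) {a : α → A} (ha : cycleWeight π a = 0) :
    ∃ f : α → A, ∀ j, f (π j) = f j + a j := by
  classical
  let δ : (α → A) →+ (α → A) :=
    { toFun := fun f j => f (π j) - f j
      map_zero' := by ext; simp
      map_add' := fun f ψ => by ext; simp; abel }
  let q := QuotientAddGroup.mk' δ.range
  -- Modulo coboundaries, a weight may be moved along its cycle.
  have hmove : ∀ t j, q (Pi.single (π j) t) = q (Pi.single j t) := fun t j => by
    rw [eq_comm, ← sub_eq_zero, ← map_sub]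
    refine (QuotientAddGroup.eq_zero_iff _).2 ⟨Pi.single (π j) t, ?_⟩
    ext i
    simp [δ, Pi.single_apply]
  have hcycle : ∀ C : CycleSet π,
      ∑ j with CycleSet.mk π j = C, q (Pi.single j (a j)) = 0 := fun C => by
    obtain ⟨i, rfl⟩ := CycleSet.mk_surjective _ C
    have hgather : ∀ j ∈ ({j | CycleSet.mk π j = CycleSet.mk π i} : Finset α),
        q (Pi.single j (a j)) = (q.comp (AddMonoidHom.single (fun _ : α => A) i)) (a j) :=
      fun j hj => CycleSet.eq_of_invariant (f := fun l => q (Pi.single l (a j))) (hmove (a j))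
        (Finset.mem_filter.1 hj).2
    rw [Finset.sum_congr rfl hgather, ← map_sum, ← cycleWeight_apply, ha, Pi.zero_apply, map_zero]
  have hq : q a = 0 := by
    rw [← Finset.univ_sum_single a, map_sum, ← Finset.sum_fiberwise Finset.univ (CycleSet.mk π)]
    exact Finset.sum_eq_zero fun C _ => hcycle C
  obtain ⟨f, hf⟩ := (QuotientAddGroup.eq_zero_iff _).1 hq
  exact ⟨f, fun j => by simp [← hf, δ]⟩

theorem exists_potential_of_cycleWeight_eq_zero (π : Perm α) (a : α → A) :
    ∃ f : α → A, ∀ j, cycleWeight π a (CycleSet.mk π j) = 0 → f (π j) = f j + a j := by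
  classical
  obtain ⟨f, hf⟩ := exists_potential π
    (a := fun j => if cycleWeight π a (CycleSet.mk π j) = 0 then a j else 0) (by
      ext C
      rw [cycleWeight_apply, Finset.sum_congr rfl (g := fun j =>
        if cycleWeight π a C = 0 then a j else 0) fun j hj => by rw [(Finset.mem_filter.1 hj).2]]
      split_ifs with hC
      · exact hC
      · simp)
  exact ⟨f, fun j hj => by rw [hf, if_pos hj]⟩

end CycleWeight

theorem addChar_sum {ι A M : Type*} [AddCommMonoid A] [CommMonoid M] (ψ : AddChar A M)
    (s : Finset ι) (a : ι → A) : ψ (∑ i ∈ s, a i) = ∏ i ∈ s, ψ (a i) :=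
  map_sum ψ.toAddMonoidHom a s

namespace GenPerm

variable {d n : ℕ} [NeZero d]

theorem mem_fixedSpace_iff (u : GenPerm d n) (v : Fin n → ℂ) :
    v ∈ Module.End.eigenspace (Matrix.toLin' u.toMatrix) 1 ↔
      ∀ j, v (u.perm j) = ZMod.stdAddChar (u.weight j) * v j := by
  rw [Module.End.mem_eigenspace_iff, one_smul, Matrix.toLin'_apply, funext_iff,
    ← u.perm.forall_congr_right]
  have hmul : ∀ j, (u.toMatrix.mulVec v) (u.perm j) = ZMod.stdAddChar (u.weight j) * v j := by
    intro j
    have hroot : Complex.exp (2 * Real.pi * Complex.I / d) ^ (u.weight j).val =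
        ZMod.stdAddChar (u.weight j) := by
      rw [ZMod.stdAddChar_apply, ZMod.toCircle_apply, ← Complex.exp_nat_mul]
      ring_nf
    simp [Matrix.mulVec, dotProduct, GenPerm.toMatrix, hroot]
  simp only [hmul, eq_comm]

theorem cycleWeight_eq_zero_of_fixed (u : GenPerm d n) {v : Fin n → ℂ}
    (hv : ∀ j, v (u.perm j) = ZMod.stdAddChar (u.weight j) * v j) {j : Fin n} (hj : v j ≠ 0) :
    cycleWeight u.perm u.weight (CycleSet.mk u.perm j) = 0 := by
  have hinv : ∀ i, (v (u.perm i) = 0) = (v i = 0) := fun i => by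
    rw [hv, mul_eq_zero, or_iff_right (AddChar.val_isUnit _ _).ne_zero]
  have hne : ∏ i with CycleSet.mk u.perm i = CycleSet.mk u.perm j, v i ≠ 0 :=
    Finset.prod_ne_zero_iff.2 fun i hi h0 => hj
      ((CycleSet.eq_of_invariant (f := fun i => v i = 0) hinv (Finset.mem_filter.1 hi).2) ▸ h0)
  have hshift : ∏ i with CycleSet.mk u.perm i = CycleSet.mk u.perm j, v (u.perm i) =
      ∏ i with CycleSet.mk u.perm i = CycleSet.mk u.perm j, v i := by
    rw [Finset.prod_filter, Finset.prod_filter, ← Equiv.prod_comp u.perm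
      (fun i => if CycleSet.mk u.perm i = CycleSet.mk u.perm j then v i else 1)]
    simp only [CycleSet.mk_apply]
  apply ZMod.injective_stdAddChar
  rw [cycleWeight_apply, addChar_sum, AddChar.map_zero_eq_one]
  refine mul_right_cancel₀ hne ?_
  rw [← Finset.prod_mul_distrib, one_mul, ← hshift]
  exact Finset.prod_congr rfl fun i _ => (hv i).symm

/-- The vector with prescribed values on the cycles of weight zero, twisted by the roots of unity
given by `f` and extended by zero to the remaining cycles. -/
noncomputable def twistedVector (u : GenPerm d n) (f : Fin n → ZMod d) :
    ({C : CycleSet u.perm // cycleWeight u.perm u.weight C = 0} → ℂ) →ₗ[ℂ] (Fin n → ℂ) :=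
  LinearMap.pi fun j => if h : cycleWeight u.perm u.weight (CycleSet.mk u.perm j) = 0
    then (ZMod.stdAddChar (f j) : ℂ) • LinearMap.proj ⟨_, h⟩ else 0

theorem twistedVector_apply (u : GenPerm d n) (f : Fin n → ZMod d)
    (c : {C : CycleSet u.perm // cycleWeight u.perm u.weight C = 0} → ℂ) (j : Fin n) :
    twistedVector u f c j = if h : cycleWeight u.perm u.weight (CycleSet.mk u.perm j) = 0
      then ZMod.stdAddChar (f j) * c ⟨_, h⟩ else 0 := by
  rw [twistedVector, LinearMap.pi_apply]
  split_ifs <;> simp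

theorem twistedVector_injective (u : GenPerm d n) (f : Fin n → ZMod d) :
    Function.Injective (twistedVector u f) := fun c e h => by
  ext ⟨C, hC⟩
  obtain ⟨j, rfl⟩ := CycleSet.mk_surjective _ C
  have hj := congrFun h j
  rw [twistedVector_apply, twistedVector_apply, dif_pos hC, dif_pos hC] at hj
  exact mul_left_cancel₀ (AddChar.val_isUnit _ _).ne_zero hj

theorem fixedSpace_eq_range_twistedVector (u : GenPerm d n) {f : Fin n → ZMod d}
    (hf : ∀ j, cycleWeight u.perm u.weight (CycleSet.mk u.perm j) = 0 →
      f (u.perm j) = f j + u.weight j) :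
    Module.End.eigenspace (Matrix.toLin' u.toMatrix) 1 = LinearMap.range (twistedVector u f) := by
  ext v
  rw [mem_fixedSpace_iff, LinearMap.mem_range]
  constructor
  · intro hv
    have hinv : ∀ j, (ZMod.stdAddChar (f (u.perm j)))⁻¹ * v (u.perm j) =
        (ZMod.stdAddChar (f j))⁻¹ * v j := fun j => by
      by_cases hj : v j = 0
      · rw [hv, hj, mul_zero, mul_zero, mul_zero]
      · rw [hf j (cycleWeight_eq_zero_of_fixed u hv hj), AddChar.map_add_eq_mul, hv, mul_inv,
          mul_assoc, inv_mul_cancel_left₀ (AddChar.val_isUnit _ _).ne_zero]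
    refine ⟨fun C => CycleSet.lift (fun j => (ZMod.stdAddChar (f j))⁻¹ * v j) hinv C, ?_⟩
    ext j
    rw [twistedVector_apply]
    split_ifs with h
    · rw [CycleSet.lift_mk, mul_inv_cancel_left₀ (AddChar.val_isUnit _ _).ne_zero]
    · by_contra hj
      exact h (cycleWeight_eq_zero_of_fixed u hv (Ne.symm hj))
  · rintro ⟨c, rfl⟩ j
    rw [twistedVector_apply, twistedVector_apply]
    simp only [CycleSet.mk_apply]
    split_ifs with h
    · rw [hf j h, AddChar.map_add_eq_mul]
      ring
    · rw [mul_zero]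

theorem fixDim_eq_card (u : GenPerm d n) :
    u.fixDim = #{C : CycleSet u.perm | cycleWeight u.perm u.weight C = 0} := by
  obtain ⟨f, hf⟩ := exists_potential_of_cycleWeight_eq_zero u.perm u.weight
  rw [fixDim, fixedSpace_eq_range_twistedVector u hf,
    LinearMap.finrank_range_of_inj (twistedVector_injective u f),
    Module.finrank_fintype_fun_eq_card, Fintype.card_subtype]

theorem pow_fixDim {M : Type*} [CommMonoid M] (u : GenPerm d n) (x : M) : x ^ u.fixDim =
    ∏ C : CycleSet u.perm, if cycleWeight u.perm u.weight C = 0 then x else 1 := by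
  rw [fixDim_eq_card, Finset.prod_ite]
  simp

end GenPerm

theorem sum_transitive_factorizations_multilinear {X ι : Type*} [Fintype X] [DecidableEq X]
    [Nontrivial X] [Fintype ι] {ς : Perm X} {b : X} (hb : ς b = b)
    (hς : ∀ x y, x ≠ b → y ≠ b → ς.SameCycle x y) {k : ℕ} (e : ι → ℚ) (y : Fin k → ι → ℚ) :
    ((Fintype.card X)! : ℚ) * ∑ π : Fin k → Perm X with IsTransitiveFactorization X π ς,
        ∏ i, ∑ j, e j * y i j ^ cycleCount (π i) =
      ∑ t ∈ Finset.range (Fintype.card X + 1), (-1) ^ t * ((Fintype.card X).choose t : ℚ) *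
        ∏ i, ∑ j, e j * (y i j * hookContentProd (Fintype.card X - 1) (t - 1) (y i j)) := by
  classical
  simp only [Fintype.prod_sum, Finset.prod_mul_distrib (f := fun _ => e _)]
  rw [Finset.sum_comm, Finset.mul_sum]
  simp only [← Finset.mul_sum, mul_left_comm ((Fintype.card X)! : ℚ),
    sum_transitive_factorizations hb hς]
  simp only [Finset.mul_sum, mul_left_comm (∏ _, e _)]
  exact Finset.sum_comm

theorem sum_prod_of_sum_eq_zero {ι A : Type*} [Fintype ι] [DecidableEq ι] [AddCommGroup A]
    [Fintype A] [DecidableEq A] (x : ℚ) :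
    (Fintype.card A : ℚ) * ∑ s : ι → A with ∑ i, s i = 0, ∏ i, (if s i = 0 then x else 1) =
      (x + Fintype.card A - 1) ^ Fintype.card ι +
        (Fintype.card A - 1) * (x - 1) ^ Fintype.card ι := by
  classical
  have hfourier : ∀ ψ : AddChar A ℂ, ∑ a, ψ a * (if a = 0 then (x : ℂ) else 1) =
      x - 1 + if ψ = 0 then (Fintype.card A : ℂ) else 0 := fun ψ => by
    have hterm : ∀ a, ψ a * (if a = 0 then (x : ℂ) else 1) =
        (if a = 0 then (x : ℂ) - 1 else 0) + ψ a := fun a => by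
      split_ifs with ha <;> simp [ha]
    simp only [hterm, Finset.sum_add_distrib, Finset.sum_ite_eq', Finset.mem_univ, if_true,
      AddChar.sum_eq_ite]
  have hsum : ∀ s : ι → A, (if ∑ i, s i = 0 then (Fintype.card A : ℂ) else 0) =
      ∑ ψ : AddChar A ℂ, ∏ i, ψ (s i) := fun s => by
    simp only [← AddChar.sum_apply_eq_ite, addChar_sum]
  suffices h : (Fintype.card A : ℂ) *
      ∑ s : ι → A with ∑ i, s i = 0, ∏ i, (if s i = 0 then (x : ℂ) else 1) =
        (x + Fintype.card A - 1) ^ Fintype.card ι +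
          (Fintype.card A - 1) * (x - 1) ^ Fintype.card ι by
    rw [← Rat.cast_inj (α := ℂ)]
    push_cast [apply_ite (Rat.cast : ℚ → ℂ)]
    exact h
  calc _ = ∑ ψ : AddChar A ℂ, ∑ s : ι → A, ∏ i, (ψ (s i) * if s i = 0 then (x : ℂ) else 1) := by
        rw [Finset.sum_filter, Finset.mul_sum, Finset.sum_comm]
        refine Finset.sum_congr rfl fun s _ => ?_
        rw [Finset.sum_congr rfl fun ψ _ => Finset.prod_mul_distrib, ← Finset.sum_mul,
          ← hsum, mul_ite, ite_mul, mul_zero, zero_mul]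
    _ = ∑ ψ : AddChar A ℂ,
          (x - 1 + if ψ = 0 then (Fintype.card A : ℂ) else 0) ^ Fintype.card ι := by
        refine Finset.sum_congr rfl fun ψ _ => ?_
        rw [← Fintype.prod_sum fun _ a => ψ a * if a = 0 then (x : ℂ) else 1]
        simp only [hfourier, Finset.prod_const, Finset.card_univ]
    _ = _ := by
        rw [← Finset.add_sum_erase _ _ (Finset.mem_univ 0), if_pos rfl,
          Finset.sum_congr rfl fun ψ hψ => by rw [if_neg (Finset.ne_of_mem_erase hψ)],
          Finset.sum_const, Finset.card_erase_of_mem (Finset.mem_univ _), Finset.card_univ,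
          AddChar.card_eq, nsmul_eq_mul, Nat.cast_pred Fintype.card_pos]
        ring

theorem card_range_mul_sum_comp {A B : Type*} [AddCommGroup A] [AddCommGroup B] [Fintype A]
    [Fintype B] (f : A →+ B) [DecidablePred (· ∈ f.range)] (g : B → ℚ) :
    (Nat.card f.range : ℚ) * ∑ a, g (f a) = Fintype.card A * ∑ b with b ∈ f.range, g b := by
  classical
  have hfiber : ∀ b ∈ f.range, #{a | f a = b} = Nat.card f.ker := fun b hb => by
    rw [AddMonoidHom.card_fiber_eq_of_mem_range f (y := 0) hb ⟨0, map_zero f⟩,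
      Nat.card_eq_fintype_card, ← Fintype.card_subtype]
    exact Fintype.card_congr (Equiv.subtypeEquivRight fun a => by simp [AddMonoidHom.mem_ker])
  have hsum : ∑ a, g (f a) = Nat.card f.ker * ∑ b with b ∈ f.range, g b := by
    rw [← Finset.sum_fiberwise_of_maps_to (t := {b | b ∈ f.range}) (g := f) (by simp),
      Finset.mul_sum]
    refine Finset.sum_congr rfl fun b hb => ?_
    rw [Finset.sum_congr rfl (g := fun _ => g b) fun a ha => by rw [(Finset.mem_filter.1 ha).2],
      Finset.sum_const, hfiber b (Finset.mem_filter.1 hb).2, nsmul_eq_mul]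
  rw [hsum, ← Nat.card_eq_fintype_card, ← f.ker.card_mul_index, AddSubgroup.index_ker]
  push_cast
  ring

/-! ### Lifting factorizations to generalized permutations -/

section Lifts

variable {X A : Type*} {k : ℕ}

/-- The product of the factors of `π` that stand to the right of the `i`-th one. -/
def suffixProd (π : Fin k → Perm X) (i : Fin k) : Perm X :=
  ((List.ofFn π).drop (i + 1)).prod

theorem suffixProd_zero (π : Fin (k + 1) → Perm X) :
    suffixProd π 0 = (List.ofFn (Fin.tail π)).prod := by
  simp [suffixProd, List.ofFn_succ, Fin.tail_def]

theorem suffixProd_succ (π : Fin (k + 1) → Perm X) (i : Fin k) :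
    suffixProd π i.succ = suffixProd (Fin.tail π) i := by
  simp [suffixProd, List.ofFn_succ, Fin.tail_def]

theorem apply_eq_of_suffixProd_invariant {β : Type*} {π : Fin k → Perm X} {f : X → β}
    (hf : ∀ i m, f ((suffixProd π i)⁻¹ (π i m)) = f ((suffixProd π i)⁻¹ m)) (i : Fin k) (m : X) :
    f (π i m) = f m := by
  induction k generalizing m with
  | zero => exact i.elim0
  | succ k ih =>
    have htail : ∀ i m, f (Fin.tail π i m) = f m :=
      ih fun i m => by rw [← suffixProd_succ]; exact hf i.succ m
    have hinv : ∀ m, f ((suffixProd π 0)⁻¹ m) = f m := fun m => by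
      rw [suffixProd_zero]
      exact apply_eq_of_mem_closure (Set.forall_mem_range.2 htail)
        (inv_mem (prod_ofFn_mem_closure _)) m
    refine Fin.cases ?_ (fun i => htail i m) i
    rw [← hinv, hf, hinv]

theorem eq_of_invariant_of_isPretransitive {β : Type*} {π : Fin k → Perm X}
    (hπ : MulAction.IsPretransitive (Subgroup.closure (Set.range π)) X) {f : X → β}
    (hf : ∀ i m, f (π i m) = f m) (x y : X) : f x = f y := by
  obtain ⟨g, rfl⟩ := hπ.exists_smul_eq x y
  exact (apply_eq_of_mem_closure (Set.forall_mem_range.2 hf) g.2 x).symm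

variable [Fintype X] [AddCommGroup A]

/-- The weights of the product `[π₁; a₁] ⋯ [π_k; a_k]`, together with the cycle weights of the
factors, as an additive function of the weights `a`. -/
noncomputable def liftHom (A : Type*) [AddCommGroup A] (π : Fin k → Perm X) :
    (Fin k → X → A) →+ (X → A) × (∀ i, CycleSet (π i) → A) where
  toFun a := (fun j => ∑ i, a i (suffixProd π i j), fun i => cycleWeight (π i) (a i))
  map_zero' := by ext <;> simp
  map_add' a b := by ext <;> simp [Finset.sum_add_distrib]

theorem liftHom_apply (π : Fin k → Perm X) (a : Fin k → X → A) : liftHom A π a =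
    (fun j => ∑ i, a i (suffixProd π i j), fun i => cycleWeight (π i) (a i)) := rfl

theorem liftHom_single [DecidableEq X] (π : Fin k → Perm X) (i : Fin k) (m : X) (t : A) :
    liftHom A π (Pi.single i (Pi.single m t)) =
      (Pi.single ((suffixProd π i)⁻¹ m) t, Pi.single i (Pi.single (CycleSet.mk (π i) m) t)) := by
  rw [liftHom_apply]
  refine Prod.ext (funext fun j => ?_) (funext fun i' => ?_)
  · dsimp only
    rw [Finset.sum_eq_single i (fun i' _ h => by simp [h]) (by simp)]
    simp [Pi.single_apply, Equiv.eq_symm_apply]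
  · rcases eq_or_ne i' i with rfl | h
    · simp [cycleWeight_single]
    · simp [h]

/-- The total weight of the product minus the total weight of the factors. -/
noncomputable def weightDefect (A : Type*) [AddCommGroup A] (π : Fin k → Perm X) :
    (X → A) × (∀ i, CycleSet (π i) → A) →+ A where
  toFun y := ∑ j, y.1 j - ∑ i, ∑ C, y.2 i C
  map_zero' := by simp
  map_add' y z := by simp [Finset.sum_add_distrib, add_sub_add_comm]

theorem weightDefect_apply (π : Fin k → Perm X) (y : (X → A) × (∀ i, CycleSet (π i) → A)) :
    weightDefect A π y = ∑ j, y.1 j - ∑ i, ∑ C, y.2 i C := rfl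

theorem weightDefect_single (π : Fin k → Perm X) (i : Fin k) (C : CycleSet (π i))
    (t : A) : weightDefect A π (0, Pi.single i (Pi.single C t)) = -t := by
  have htotal : ∑ i', ∑ C', (Pi.single i (Pi.single C t) : ∀ i, CycleSet (π i) → A) i' C' = t := by
    rw [Finset.sum_eq_single i (fun i' _ h => by simp [h]) (by simp)]
    simp
  rw [weightDefect_apply, htotal]
  simp

theorem weightDefect_liftHom (π : Fin k → Perm X) (a : Fin k → X → A) :
    weightDefect A π (liftHom A π a) = 0 := by
  simp only [weightDefect_apply, liftHom_apply, sum_cycleWeight]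
  rw [Finset.sum_comm, sub_eq_zero]
  exact Finset.sum_congr rfl fun i _ => Equiv.sum_comp (suffixProd π i) (a i)

theorem exists_eq_comp_weightDefect [Nonempty X] {π : Fin k → Perm X}
    (hπ : MulAction.IsPretransitive (Subgroup.closure (Set.range π)) X) {B : Type*}
    [AddCommGroup B] {q : (X → A) × (∀ i, CycleSet (π i) → A) →+ B}
    (hq : q.comp (liftHom A π) = 0) : ∃ u : A →+ B, q = u.comp (weightDefect A π) := by
  classical
  let u (j : X) : A →+ B := (q.comp (.inl _ _)).comp (.single (fun _ => A) j)
  have hcycle : ∀ i m t, q (0, Pi.single i (Pi.single (CycleSet.mk (π i) m) t)) =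
      -u ((suffixProd π i)⁻¹ m) t := fun i m t => by
    rw [eq_neg_iff_add_eq_zero]
    simpa [u, liftHom_single, ← map_add] using
      DFunLike.congr_fun hq (Pi.single i (Pi.single m t))
  have hconst : ∀ x y, u x = u y :=
    eq_of_invariant_of_isPretransitive hπ <| apply_eq_of_suffixProd_invariant fun i m => by
      ext t
      rw [← neg_inj, ← hcycle, ← hcycle, CycleSet.mk_apply]
  obtain ⟨b⟩ := ‹Nonempty X›
  refine ⟨u b, ?_⟩
  rw [← AddMonoidHom.coprod_unique q, ← AddMonoidHom.coprod_unique ((u b).comp _)]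
  congr 1
  · refine AddMonoidHom.functions_ext _ _ _ fun j t => ?_
    rw [hconst b j]
    simp [u, weightDefect_apply]
  · refine AddMonoidHom.functions_ext' _ _ _ fun i =>
      AddMonoidHom.functions_ext (M := fun _ : CycleSet (π i) => A) _ _ _ fun C t => ?_
    obtain ⟨m, rfl⟩ := CycleSet.mk_surjective (π i) C
    change q (0, Pi.single i (Pi.single (CycleSet.mk (π i) m) t)) =
      u b (weightDefect A π (0, Pi.single i (Pi.single (CycleSet.mk (π i) m) t)))
    rw [hcycle, hconst _ b, weightDefect_single, map_neg]

theorem range_liftHom [Nonempty X] {π : Fin k → Perm X}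
    (hπ : MulAction.IsPretransitive (Subgroup.closure (Set.range π)) X) :
    (liftHom A π).range = (weightDefect A π).ker := by
  refine le_antisymm ?_ fun y hy => ?_
  · rintro _ ⟨a, rfl⟩
    exact weightDefect_liftHom π a
  · obtain ⟨u, hu⟩ := exists_eq_comp_weightDefect hπ
      (q := QuotientAddGroup.mk' (liftHom A π).range) (by
        refine AddMonoidHom.ext fun a => (QuotientAddGroup.eq_zero_iff _).2 ?_
        exact AddMonoidHom.mem_range.2 ⟨a, rfl⟩)
    refine (QuotientAddGroup.eq_zero_iff y).1 ((DFunLike.congr_fun hu y).trans ?_)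
    rw [AddMonoidHom.comp_apply, AddMonoidHom.mem_ker.1 hy, map_zero]

theorem card_mul_card_range_liftHom [Nonempty X] [Finite A] {π : Fin k → Perm X}
    (hπ : MulAction.IsPretransitive (Subgroup.closure (Set.range π)) X) :
    Nat.card A * Nat.card (liftHom A π).range =
      Nat.card A ^ Fintype.card X * ∏ i, Nat.card A ^ cycleCount (π i) := by
  classical
  have hsurj : Function.Surjective (weightDefect A π) := fun t =>
    ⟨(Pi.single (Classical.arbitrary X) t, 0), by simp [weightDefect_apply]⟩
  have h := (weightDefect A π).ker.card_mul_index
  rw [AddSubgroup.index_ker, AddMonoidHom.range_eq_top.2 hsurj, AddSubgroup.card_top] at h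
  rw [range_liftHom hπ, mul_comm, h, Nat.card_prod, Nat.card_pi]
  simp [cycleCount, Nat.card_pi]

theorem sum_lifts [Nonempty X] [DecidableEq X] [Fintype A] [DecidableEq A] {π : Fin k → Perm X}
    (hπ : MulAction.IsPretransitive (Subgroup.closure (Set.range π)) X) {w : X → A}
    (hw : ∑ j, w j = 0) (F : ∀ i, (CycleSet (π i) → A) → ℚ) :
    ((Fintype.card A : ℚ) ^ Fintype.card X * ∏ i, (Fintype.card A : ℚ) ^ cycleCount (π i)) *
        ∑ a with (liftHom A π a).1 = w ∧ ∀ i, ∑ j, a i j = 0, ∏ i, F i (cycleWeight (π i) (a i)) =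
      (Fintype.card A : ℚ) ^ (k * Fintype.card X + 1) *
        ∏ i, ∑ s : CycleSet (π i) → A with ∑ C, s C = 0, F i s := by
  let g (y : (X → A) × (∀ i, CycleSet (π i) → A)) : ℚ :=
    if y.1 = w ∧ ∀ i, ∑ C, y.2 i C = 0 then ∏ i, F i (y.2 i) else 0
  have hleft : ∑ a with (liftHom A π a).1 = w ∧ ∀ i, ∑ j, a i j = 0,
      ∏ i, F i (cycleWeight (π i) (a i)) = ∑ a, g (liftHom A π a) := by
    rw [Finset.sum_filter]
    refine Finset.sum_congr rfl fun a _ => if_congr ?_ rfl rfl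
    simp only [liftHom_apply, sum_cycleWeight]
  classical
  have hmem : ∀ y, g y ≠ 0 → y ∈ (liftHom A π).range := fun y hy => by
    obtain ⟨h₁, h₂⟩ := (ite_ne_right_iff.1 hy).1
    rw [range_liftHom hπ, AddMonoidHom.mem_ker, weightDefect_apply, h₁, hw,
      Finset.sum_eq_zero fun i _ => h₂ i, sub_zero]
  have hright : ∑ y with y ∈ (liftHom A π).range, g y =
      ∏ i, ∑ s : CycleSet (π i) → A with ∑ C, s C = 0, F i s := by
    rw [Finset.sum_filter_of_ne fun y _ => hmem y, Fintype.sum_prod_type,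
      Finset.sum_eq_single w (fun v _ hv => by simp [g, hv]) (by simp)]
    simp only [g, true_and, Finset.sum_filter, Fintype.prod_sum, Finset.prod_ite_zero,
      Finset.mem_univ, true_imp_iff]
  have hcard := congrArg (Nat.cast (R := ℚ)) (card_mul_card_range_liftHom (A := A) hπ)
  rw [Nat.card_eq_fintype_card (α := A)] at hcard
  push_cast at hcard
  rw [hleft, ← hcard, mul_assoc, card_range_mul_sum_comp, hright]
  simp only [Fintype.card_pi, Finset.prod_const, Finset.card_univ, Fintype.card_fin, Nat.cast_pow]
  ring

end Lifts

section CoxeterElements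

variable {d n : ℕ}

theorem lt_of_cycleRange_eq_self {m : ℕ} {i z : Fin (m + 1)} (hi : i ≠ 0)
    (h : Fin.cycleRange i z = z) : i < z := by
  rw [Fin.cycleRange_apply] at h
  split_ifs at h with hlt heq
  · exact absurd h (Fin.lt_add_one_iff.2 (hlt.trans_le (Fin.le_last i))).ne'
  · exact absurd (heq.symm.trans h.symm) hi
  · exact lt_of_le_of_ne (not_lt.1 hlt) (Ne.symm heq)

theorem cycleRange_sameCycle {m : ℕ} {x y : Fin (m + 2)} (hx : x ≠ Fin.last (m + 1))
    (hy : y ≠ Fin.last (m + 1)) :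
    (Fin.cycleRange (⟨m, by omega⟩ : Fin (m + 2))).SameCycle x y := by
  obtain ⟨x, rfl⟩ := Fin.exists_castSucc_eq.2 hx
  obtain ⟨y, rfl⟩ := Fin.exists_castSucc_eq.2 hy
  rcases m with _ | m
  · rw [Subsingleton.elim (α := Fin 1) x y]
  · have hm : (⟨m + 1, by omega⟩ : Fin (m + 3)) ≠ 0 := by simp [Fin.ext_iff]
    have hmove : ∀ z : Fin (m + 2), Fin.cycleRange ⟨m + 1, by omega⟩ z.castSucc ≠ z.castSucc :=
      fun z h => (Nat.le_of_lt_succ z.2).not_gt (Fin.lt_def.1 (lt_of_cycleRange_eq_self hm h))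
    exact (Fin.isCycle_cycleRange hm).sameCycle (hmove x) (hmove y)

theorem coxeterElement_apply_last {m : ℕ} (hm : 2 ≤ m + 2) (a : ZMod d) :
    (coxeterElement d (m + 2) hm a : GenPerm d (m + 2)).perm (Fin.last (m + 1)) =
      Fin.last (m + 1) :=
  Fin.cycleRange_of_gt (Fin.lt_def.2 (by simp))

theorem coxeterElement_weight_last {m : ℕ} (hm : 2 ≤ m + 2) (a : ZMod d) :
    (coxeterElement d (m + 2) hm a : GenPerm d (m + 2)).weight (Fin.last (m + 1)) = -a := by
  simp [coxeterElement]

theorem IsCoxeterElement.exists_fixed_point {hn : 2 ≤ n} {c : Gddn d n}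
    (hc : IsCoxeterElement d n hn c) : ∃ b : Fin n, (c : GenPerm d n).perm b = b ∧
      (∀ x y, x ≠ b → y ≠ b → (c : GenPerm d n).perm.SameCycle x y) ∧
      IsUnit ((c : GenPerm d n).weight b) := by
  obtain ⟨m, rfl⟩ : ∃ m, n = m + 2 := ⟨n - 2, by omega⟩
  obtain ⟨a, ha⟩ := hc
  obtain ⟨g, rfl⟩ := isConj_iff.1 ha
  simp only [Subgroup.coe_mul, Subgroup.coe_inv, GenPerm.mul_perm, GenPerm.inv_perm]
  refine ⟨(g : GenPerm d (m + 2)).perm (Fin.last (m + 1)), ?_, fun x y hx hy => ?_, ?_⟩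
  · simp [coxeterElement_apply_last]
  · rw [Perm.sameCycle_conj]
    exact cycleRange_sameCycle (mt Perm.inv_eq_iff_eq.1 hx) (mt Perm.inv_eq_iff_eq.1 hy)
  · simp [coxeterElement_apply_last, coxeterElement_weight_last]

namespace GenPerm

/-- The projection `[π; a] ↦ π` of `G(d,1,n)` onto the symmetric group. -/
def permHom (d n : ℕ) : GenPerm d n →* Perm (Fin n) where
  toFun u := u.perm
  map_one' := rfl
  map_mul' _ _ := rfl

theorem prod_ofFn_perm {k : ℕ} (u : Fin k → GenPerm d n) :
    (List.ofFn u).prod.perm = (List.ofFn fun i => (u i).perm).prod := by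
  have h := map_list_prod (permHom d n) (List.ofFn u)
  rwa [List.map_ofFn] at h

theorem prod_ofFn_weight {k : ℕ} (u : Fin k → GenPerm d n) :
    (List.ofFn u).prod.weight =
      (liftHom (ZMod d) (fun i => (u i).perm) fun i => (u i).weight).1 := by
  induction k with
  | zero => rfl
  | succ k ih =>
    funext j
    rw [List.ofFn_succ, List.prod_cons, mul_weight, prod_ofFn_perm, ih, liftHom_apply,
      liftHom_apply]
    simp only [Fin.sum_univ_succ, suffixProd_zero, suffixProd_succ]
    rfl

theorem smul_def (g : GenPerm d n) (y : Fin n × ZMod d) :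
    g • y = (g.perm y.1, y.2 + g.weight y.1) := rfl

theorem pow_smul_of_perm_eq_self {c : GenPerm d n} {b : Fin n} (hb : c.perm b = b) (m : ℕ)
    (s : ZMod d) : c ^ m • (b, s) = (b, s + m * c.weight b) := by
  induction m with
  | zero => simp
  | succ m ih =>
    rw [pow_succ', mul_smul, ih, smul_def]
    simp only [hb, Nat.cast_succ]
    congr 1
    ring

end GenPerm

theorem map_permHom_closure {k : ℕ} (u : Fin k → Gddn d n) :
    (Subgroup.closure (Set.range u)).map ((GenPerm.permHom d n).comp (Gddn d n).subtype) =
      Subgroup.closure (Set.range fun i => (u i : GenPerm d n).perm) := by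
  rw [MonoidHom.map_closure, ← Set.range_comp]
  rfl

theorem isPretransitive_closure_iff_perm [NeZero d] {c : Gddn d n} {b : Fin n}
    (hb : (c : GenPerm d n).perm b = b) (hw : IsUnit ((c : GenPerm d n).weight b)) {k : ℕ}
    {u : Fin k → Gddn d n} (hu : (List.ofFn u).prod = c) :
    MulAction.IsPretransitive (Subgroup.closure (Set.range u)) (Fin n × ZMod d) ↔
      MulAction.IsPretransitive (Subgroup.closure (Set.range fun i => (u i : GenPerm d n).perm))
        (Fin n) := by
  refine ⟨fun h => ⟨fun x y => ?_⟩, fun h => ?_⟩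
  · obtain ⟨g, hg⟩ := h.exists_smul_eq (x, 0) (y, 0)
    exact ⟨⟨_, map_permHom_closure u ▸ Subgroup.mem_map_of_mem _ g.2⟩, congrArg Prod.fst hg⟩
  · rw [MulAction.isPretransitive_iff_base (b, (0 : ZMod d))]
    rintro ⟨y, t⟩
    obtain ⟨⟨π, hπ⟩, hπb⟩ := h.exists_smul_eq b y
    rw [← map_permHom_closure] at hπ
    obtain ⟨g, hg, rfl⟩ := hπ
    have hgb : (g : GenPerm d n).perm b = y := hπb
    have hcmem : c ∈ Subgroup.closure (Set.range u) := hu ▸ prod_ofFn_mem_closure u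
    obtain ⟨w, hw⟩ := hw
    -- the powers of `c` move `ω ^ i • e_b` through all its multiples, as `c.weight b` is a unit
    let m := ((t - (g : GenPerm d n).weight b) * ((w⁻¹ : (ZMod d)ˣ) : ZMod d)).val
    refine ⟨⟨g * c ^ m, mul_mem hg (pow_mem hcmem m)⟩, ?_⟩
    change ((g : GenPerm d n) * (c : GenPerm d n) ^ m) • (b, (0 : ZMod d)) = (y, t)
    rw [mul_smul, GenPerm.pow_smul_of_perm_eq_self hb, GenPerm.smul_def, ← hw]
    simp [m, hgb]

theorem prod_ofFn_eq_iff {k : ℕ} (u : Fin k → Gddn d n) (c : Gddn d n) :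
    (List.ofFn u).prod = c ↔
      (List.ofFn fun i => (u i : GenPerm d n).perm).prod = (c : GenPerm d n).perm ∧
      (liftHom (ZMod d) (fun i => (u i : GenPerm d n).perm) fun i => (u i : GenPerm d n).weight).1
        = (c : GenPerm d n).weight := by
  have h := map_list_prod (Gddn d n).subtype (List.ofFn u)
  rw [List.map_ofFn] at h
  rw [← Subtype.coe_inj, ← Subgroup.subtype_apply, h, GenPerm.ext_iff, GenPerm.prod_ofFn_perm,
    GenPerm.prod_ofFn_weight]
  rfl

theorem isTransitiveFactorization_iff_perm [NeZero d] {c : Gddn d n} {b : Fin n}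
    (hb : (c : GenPerm d n).perm b = b) (hw : IsUnit ((c : GenPerm d n).weight b)) {k : ℕ}
    (u : Fin k → Gddn d n) :
    IsTransitiveFactorization (Fin n × ZMod d) u c ↔
      IsTransitiveFactorization (Fin n) (fun i => (u i : GenPerm d n).perm)
          (c : GenPerm d n).perm ∧
        (liftHom (ZMod d) (fun i => (u i : GenPerm d n).perm)
          fun i => (u i : GenPerm d n).weight).1 = (c : GenPerm d n).weight := by
  rw [IsTransitiveFactorization, IsTransitiveFactorization,
    and_congr_right (isPretransitive_closure_iff_perm hb hw), prod_ofFn_eq_iff]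
  exact and_right_comm

instance GenPerm.instFinite [NeZero d] : Finite (GenPerm d n) :=
  Finite.of_injective (fun u => (u.perm, u.weight)) fun _ _ h =>
    GenPerm.ext (congrArg Prod.fst h) (congrArg Prod.snd h)

noncomputable instance [NeZero d] : Fintype (Gddn d n) := Fintype.ofFinite _

theorem card_Gddn [NeZero d] [NeZero n] : d * Nat.card (Gddn d n) = d ^ n * n ! := by
  let f : (Fin n → ZMod d) →+ ZMod d := ∑ j, Pi.evalAddMonoidHom _ j
  have hf : ∀ a, f a = ∑ j, a j := fun a => by simp [f]
  have hsurj : Function.Surjective f := fun t => ⟨Pi.single 0 t, by simp [hf]⟩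
  have hcard : d * Nat.card f.ker = d ^ n := by
    simpa [AddSubgroup.index_ker, AddMonoidHom.range_eq_top.2 hsurj, mul_comm] using
      f.ker.card_mul_index
  have e : Gddn d n ≃ Perm (Fin n) × f.ker :=
    { toFun u := (u.1.perm, ⟨u.1.weight, (hf _).trans u.2⟩)
      invFun y := ⟨⟨y.1, y.2.1⟩, (hf _).symm.trans y.2.2⟩ }
  rw [Nat.card_congr e, Nat.card_prod, mul_left_comm, hcard, mul_comm]
  simp [Nat.card_eq_fintype_card, Fintype.card_perm]

/-- The generating function of the transitive factorizations of `c` into `k` factors by the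
dimensions of the fixed spaces, evaluated at `x`. -/
noncomputable def transFactEnum [NeZero d] (c : Gddn d n) {k : ℕ} (x : Fin k → ℚ) : ℚ :=
  ∑ u : Fin k → Gddn d n with IsTransitiveFactorization (Fin n × ZMod d) u c,
    ∏ i, x i ^ (u i : GenPerm d n).fixDim

theorem transFactEnum_eq_sum_lifts [NeZero d] {c : Gddn d n} {b : Fin n}
    (hb : (c : GenPerm d n).perm b = b) (hw : IsUnit ((c : GenPerm d n).weight b)) {k : ℕ}
    (x : Fin k → ℚ) : transFactEnum c x =
      ∑ π with IsTransitiveFactorization (Fin n) π (c : GenPerm d n).perm,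
        ∑ a with (liftHom (ZMod d) π a).1 = (c : GenPerm d n).weight ∧ ∀ i, ∑ j, a i j = 0,
          ∏ i, ∏ C : CycleSet (π i), if cycleWeight (π i) (a i) C = 0 then x i else 1 := by
  rw [transFactEnum, Finset.sum_sigma']
  refine Finset.sum_bij' (fun u _ => ⟨fun i => (u i : GenPerm d n).perm,
    fun i => (u i : GenPerm d n).weight⟩) (fun y hy i => ⟨⟨y.1 i, y.2 i⟩, ?_⟩) ?_ ?_ ?_ ?_ ?_
  · simp only [Finset.mem_sigma, Finset.mem_filter] at hy
    exact hy.2.2.2 i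
  · intro u hu
    obtain ⟨h₁, h₂⟩ := (isTransitiveFactorization_iff_perm hb hw u).1 (Finset.mem_filter.1 hu).2
    simpa using ⟨h₁, h₂, fun i => (u i).2⟩
  · intro y hy
    simp only [Finset.mem_sigma, Finset.mem_filter] at hy
    exact Finset.mem_filter.2 ⟨Finset.mem_univ _,
      (isTransitiveFactorization_iff_perm hb hw _).2 ⟨hy.1.2, hy.2.2.1⟩⟩
  · exact fun _ _ => rfl
  · exact fun _ _ => rfl
  · exact fun u _ => Finset.prod_congr rfl fun i _ => GenPerm.pow_fixDim _ _

/-- The two points at which the cycle enumerator of a permutation is evaluated, with the weights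
`nodeWeight`, to count its lifts to `G(d,d,n)` by the dimension of the fixed space: the values of
the Fourier transform on `ℤ/d` at the trivial and at a nontrivial character, divided by `d`. -/
noncomputable def node (d : ℕ) (x : ℚ) : Fin 2 → ℚ := ![(x + d - 1) / d, (x - 1) / d]

/-- The numbers of characters of `ℤ/d` that contribute to the two points `node`. -/
def nodeWeight (d : ℕ) : Fin 2 → ℚ := ![1, d - 1]

theorem sum_prod_cycleSet_eq_sum_node [NeZero d] (π : Perm (Fin n)) (x : ℚ) :
    (d : ℚ) * ∑ s : CycleSet π → ZMod d with ∑ C, s C = 0, ∏ C, (if s C = 0 then x else 1) =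
      (d : ℚ) ^ cycleCount π * ∑ j, nodeWeight d j * node d x j ^ cycleCount π := by
  have hd : (d : ℚ) ≠ 0 := Nat.cast_ne_zero.2 (NeZero.ne d)
  have h := sum_prod_of_sum_eq_zero (ι := CycleSet π) (A := ZMod d) x
  rw [ZMod.card, ← Nat.card_eq_fintype_card (α := CycleSet π)] at h
  rw [h, cycleCount, Fin.sum_univ_two]
  simp only [node, nodeWeight, Matrix.cons_val_zero, Matrix.cons_val_one, div_pow]
  field_simp

theorem sum_lifts_eq_prod_sum_node [NeZero d] [NeZero n] {k : ℕ} {π : Fin k → Perm (Fin n)}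
    (hπ : MulAction.IsPretransitive (Subgroup.closure (Set.range π)) (Fin n))
    {w : Fin n → ZMod d} (hw : ∑ j, w j = 0) (x : Fin k → ℚ) :
    (d : ℚ) ^ n * d ^ k * ∑ a with (liftHom (ZMod d) π a).1 = w ∧ ∀ i, ∑ j, a i j = 0,
        ∏ i, ∏ C : CycleSet (π i), (if cycleWeight (π i) (a i) C = 0 then x i else 1) =
      (d : ℚ) ^ (k * n + 1) * ∏ i, ∑ j, nodeWeight d j * node d (x i) j ^ cycleCount (π i) := by
  have hd : (d : ℚ) ≠ 0 := Nat.cast_ne_zero.2 (NeZero.ne d)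
  have h := sum_lifts hπ hw fun i s => ∏ C, if s C = 0 then x i else 1
  rw [ZMod.card, Fintype.card_fin] at h
  have hprod := Finset.prod_congr (rfl : Finset.univ = Finset.univ) fun i _ =>
    sum_prod_cycleSet_eq_sum_node (d := d) (π i) (x i)
  simp only [Finset.prod_mul_distrib, Finset.prod_const, Finset.card_univ,
    Fintype.card_fin] at hprod
  refine mul_left_cancel₀
    (Finset.prod_ne_zero_iff.2 fun i _ => pow_ne_zero (cycleCount (π i)) hd :
      ∏ i, (d : ℚ) ^ cycleCount (π i) ≠ 0) ?_
  linear_combination (d : ℚ) ^ k * h + (d : ℚ) ^ (k * n + 1) * hprod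

theorem factorial_mul_transFactEnum [NeZero d] {hn : 2 ≤ n} {c : Gddn d n}
    (hc : IsCoxeterElement d n hn c) {k : ℕ} (x : Fin k → ℚ) :
    (n ! : ℚ) * d ^ n * d ^ k * transFactEnum c x =
      d ^ (k * n + 1) * ∑ t ∈ Finset.range (n + 1), (-1) ^ t * (n.choose t : ℚ) *
        ∏ i, ∑ j, nodeWeight d j *
          (node d (x i) j * hookContentProd (n - 1) (t - 1) (node d (x i) j)) := by
  have : NeZero n := ⟨by omega⟩
  have : Nontrivial (Fin n) := Fin.nontrivial_iff_two_le.2 hn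
  obtain ⟨b, hb, hς, hw⟩ := hc.exists_fixed_point
  have h := sum_transitive_factorizations_multilinear hb hς (nodeWeight d) fun i => node d (x i)
  rw [Fintype.card_fin] at h
  rw [← h, transFactEnum_eq_sum_lifts hb hw, mul_assoc, mul_assoc, ← mul_assoc ((d : ℚ) ^ n),
    Finset.mul_sum, Finset.sum_congr rfl fun π hπ =>
      sum_lifts_eq_prod_sum_node (Finset.mem_filter.1 hπ).2.2 c.2 x, ← Finset.mul_sum]
  ring

end CoxeterElements

/-! ### The basis `P_p` and the coefficients `M^n` -/

section NormalizedBasis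

theorem ring_choose_succ_mul {R : Type*} [CommRing R] [BinomialRing R] (z : R) (i : ℕ) :
    ((i : R) + 1) * Ring.choose z (i + 1) = (z - i) * Ring.choose z i := by
  have h := Ring.choose_smul_choose z (Nat.le_succ i)
  rw [Nat.succ_sub (le_refl i), Nat.sub_self, Ring.choose_one_right, Nat.choose_succ_self_right,
    nsmul_eq_mul, mul_comm (Ring.choose z i)] at h
  exact_mod_cast h

theorem mul_ring_choose_sub_one {R : Type*} [CommRing R] [BinomialRing R] (z : R) (i : ℕ) :
    z * Ring.choose (z - 1) i = (z - i) * Ring.choose z i := by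
  have h := Ring.choose_smul_choose z (Nat.le_add_left 1 i)
  rw [Nat.choose_one_right, Ring.choose_one_right, nsmul_eq_mul, Nat.add_sub_cancel,
    Nat.cast_one] at h
  rw [← h, ← ring_choose_succ_mul, Nat.cast_succ]

theorem eval_stepFalling {d : ℕ} (hd : d ≠ 0) (p : ℕ) (x : ℚ) :
    (stepFalling d p).eval x = d ^ p * p ! * Ring.choose ((x - 1) / d) p := by
  induction p with
  | zero => simp [stepFalling]
  | succ p ih =>
    have h := ring_choose_succ_mul ((x - 1) / d) p
    rw [stepFalling, Finset.prod_range_succ, ← stepFalling, Polynomial.eval_mul, ih]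
    simp only [Polynomial.eval_sub, Polynomial.eval_X, Polynomial.eval_C, Nat.factorial_succ,
      Nat.cast_mul, Nat.cast_succ]
    field_simp at h ⊢
    linear_combination -(d : ℚ) ^ p * h

/-- The value `P_p(x) / (d ^ (p - 1) (p - 1)!)` of the normalized basis polynomial. -/
noncomputable def normP (d p : ℕ) (x : ℚ) : ℚ :=
  1 / ((d : ℚ) ^ (p - 1) * ((p - 1)! : ℚ)) * (polyP d p).eval x

theorem normP_succ {d : ℕ} (hd : d ≠ 0) (i : ℕ) (x : ℚ) :
    normP d (i + 1) x = Ring.choose ((x - 1) / d) i * (x - i * (d - 1)) := by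
  rw [normP, polyP, Polynomial.eval_mul, eval_stepFalling hd]
  simp only [Polynomial.eval_sub, Polynomial.eval_X, Polynomial.eval_C, Nat.add_sub_cancel]
  field_simp

theorem hookContentProd_eq_sum {N t : ℕ} (ht : t ≤ N + 1) (y : ℚ) :
    hookContentProd N (t - 1) y = N ! * ∑ i ∈ Finset.range (N + 1),
      Ring.choose (y - 1) i * ((N + 1 - t).choose (N - i) : ℚ) := by
  have h := Ring.factorial_nsmul_multichoose_eq_ascPochhammer (y - (t - 1)) N
  have hy : y - ((t : ℚ) - 1) + N - 1 = y - 1 + ((N + 1 - t : ℕ) : ℚ) := by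
    push_cast [Nat.cast_sub ht]
    ring
  rw [Polynomial.ascPochhammer_smeval_eq_eval, nsmul_eq_mul, Ring.multichoose_eq, hy,
    Ring.add_choose_eq _ (Commute.all _ _),
    Finset.Nat.sum_antidiagonal_eq_sum_range_succ_mk] at h
  simp only [Ring.choose_natCast] at h
  rw [hookContentProd, ← h]

theorem sum_nodeWeight_mul_ring_choose {d : ℕ} (hd : d ≠ 0) (i : ℕ) (x : ℚ) :
    ∑ j, nodeWeight d j * (node d x j * Ring.choose (node d x j - 1) i) = normP d (i + 1) x := by
  have hd' : (d : ℚ) ≠ 0 := Nat.cast_ne_zero.2 hd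
  have hnode : (x + d - 1) / d = (x - 1) / d + 1 := by field_simp; ring
  have hx : x = d * ((x - 1) / d) + 1 := by field_simp; ring
  rw [normP_succ hd, Fin.sum_univ_two]
  simp only [nodeWeight, node, Matrix.cons_val_zero, Matrix.cons_val_one, hnode,
    add_sub_cancel_right, mul_ring_choose_sub_one]
  linear_combination -Ring.choose ((x - 1) / d) i * hx

theorem sum_nodeWeight_mul_hookContentProd {d : ℕ} (hd : d ≠ 0) {N t : ℕ} (ht : t ≤ N + 1)
    (x : ℚ) :
    ∑ j, nodeWeight d j * (node d x j * hookContentProd N (t - 1) (node d x j)) =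
      N ! * ∑ p ∈ Finset.Icc 1 (N + 1), ((N + 1 - t).choose (N + 1 - p) : ℚ) * normP d p x := by
  have hshift : ∑ p ∈ Finset.Icc 1 (N + 1), ((N + 1 - t).choose (N + 1 - p) : ℚ) * normP d p x =
      ∑ i ∈ Finset.range (N + 1), ((N + 1 - t).choose (N - i) : ℚ) * normP d (i + 1) x := by
    rw [Finset.range_eq_Ico, ← Finset.Ico_succ_right_eq_Icc, Order.succ_eq_add_one,
      ← zero_add 1, ← Finset.sum_Ico_add']
    simp only [Nat.add_sub_add_right, zero_add]
  simp only [hookContentProd_eq_sum ht, hshift, ← sum_nodeWeight_mul_ring_choose hd,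
    Finset.mul_sum]
  rw [Finset.sum_comm]
  exact Finset.sum_congr rfl fun i _ => Finset.sum_congr rfl fun j _ => by ring

end NormalizedBasis

section CoeffM

theorem coeffM_eq_sum {n k : ℕ} [NeZero k] {p : Fin k → ℕ} (hp : ∀ i, p i ≤ n) :
    coeffM n p = ∑ t ∈ Finset.range (n + 1), (-1) ^ t * (n.choose t : ℤ) *
      ∏ i, ((n - t).choose (n - p i) : ℤ) := by
  have hle : ∀ i, (⨅ i, p i) ≤ p i := fun i => ciInf_le (OrderBot.bddBelow _) i
  obtain ⟨i₀, hi₀⟩ := exists_eq_ciInf_of_finite (f := p)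
  have hsub : Finset.range ((⨅ i, p i) + 1) ⊆ Finset.range (n + 1) :=
    Finset.range_mono (Nat.succ_le_succ (hi₀ ▸ hp i₀))
  rw [coeffM, ← Finset.sum_subset hsub fun t ht ht' => ?_]
  · refine Finset.sum_congr rfl fun t ht => congrArg _ (Finset.prod_congr rfl fun i _ => ?_)
    have hti : t ≤ p i := (Finset.mem_range_succ_iff.1 ht).trans (hle i)
    rw [← Nat.choose_symm (Nat.sub_le_sub_right (hp i) t), Nat.sub_sub_sub_cancel_right hti]
  · rw [Finset.mem_range] at ht ht'
    rw [Finset.prod_eq_zero (Finset.mem_univ i₀), mul_zero]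
    rw [Nat.choose_eq_zero_of_lt (by omega), Nat.cast_zero]

theorem fwdDiff_iter_choose_apply (m p N : ℕ) :
    (fwdDiff 1)^[p] (fun x ↦ x.choose m : ℕ → ℤ) N =
      if p ≤ m then (N.choose (m - p) : ℤ) else 0 := by
  split_ifs with h
  · obtain ⟨j, rfl⟩ := Nat.exists_eq_add_of_le h
    rw [fwdDiff_iter_choose, Nat.add_sub_cancel_left]
  · obtain ⟨j, rfl⟩ := Nat.exists_eq_add_of_lt (not_le.1 h)
    have hconst := fwdDiff_iter_choose 0 m
    simp only [add_zero, Nat.choose_zero_right, Nat.cast_one] at hconst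
    rw [add_assoc, add_comm m, Function.iterate_add_apply, hconst, Function.iterate_succ_apply,
      fwdDiff_const]
    simp [fwdDiff_iter_eq_sum_shift]

theorem sum_alternating_choose_mul_choose {n p q : ℕ} (hp : p ≤ n) (hq : q ≤ n) :
    ∑ t ∈ Finset.range (p + 1), (-1) ^ t * (p.choose t : ℤ) * ((n - t).choose (n - q) : ℤ) =
      (n - p).choose q := by
  have h := fwdDiff_iter_choose_apply (n - q) p (n - p)
  rw [fwdDiff_iter_eq_sum_shift, ← Finset.sum_range_reflect] at h
  refine (Finset.sum_congr rfl fun t ht => ?_).trans (h.trans ?_)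
  · have htp := Finset.mem_range_succ_iff.1 ht
    rw [Nat.add_sub_cancel, Nat.sub_sub_self htp, Nat.choose_symm htp, smul_eq_mul, smul_eq_mul,
      mul_one, Nat.sub_add_sub_cancel hp htp]
  split_ifs with hpq
  · rw [← Nat.choose_symm (by omega : q ≤ n - p), Nat.sub_right_comm]
  · rw [Nat.choose_eq_zero_of_lt (by omega), Nat.cast_zero]

theorem coeffM_pair {n p q : ℕ} (hp : p ≤ n) (hq : q ≤ n) :
    coeffM n ![p, q] = n.choose p * (n - p).choose q := by
  rw [coeffM_eq_sum (by simp [Fin.forall_fin_two, hp, hq]),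
    ← sum_alternating_choose_mul_choose hp hq, Finset.mul_sum,
    ← Finset.sum_subset (Finset.range_mono (Nat.succ_le_succ hp)) fun t ht ht' => ?_]
  · refine Finset.sum_congr rfl fun t ht => ?_
    have htp := Finset.mem_range_succ_iff.1 ht
    have h := Nat.choose_mul (n := n) htp
    rw [← Nat.choose_symm (Nat.sub_le_sub_right hp t), Nat.sub_sub_sub_cancel_right htp] at h
    have hcast : (n.choose p * p.choose t : ℤ) = n.choose t * (n - t).choose (n - p) := by
      exact_mod_cast h
    simp only [Fin.prod_univ_two, Matrix.cons_val_zero, Matrix.cons_val_one]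
    linear_combination -(-1 : ℤ) ^ t * ((n - t).choose (n - q) : ℤ) * hcast
  · rw [Finset.mem_range] at ht ht'
    simp [Fin.prod_univ_two, Nat.choose_eq_zero_of_lt (show n - t < n - p by omega)]

theorem coeffM_pair_div {n p q : ℕ} (hn : 2 ≤ n) (hp : 1 ≤ p) (hq : 1 ≤ q) :
    (coeffM n ![p, q] : ℚ) / ((n : ℚ) * (n - 1)) =
      trinomial (n - 2) (p - 1) (q - 1) / ((p : ℚ) * q) := by
  rcases lt_or_ge n p with hpn | hpn
  · rw [coeffM_eq_zero n ![p, q] 0 hpn, trinomial, if_neg (by omega)]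
    simp
  rcases lt_or_ge n q with hqn | hqn
  · rw [coeffM_eq_zero n ![p, q] 1 hqn, trinomial, if_neg (by omega)]
    simp
  rw [coeffM_pair hpn hqn, trinomial]
  obtain ⟨N, rfl⟩ := Nat.exists_eq_add_of_le' hn
  obtain ⟨a, rfl⟩ := Nat.exists_eq_add_of_le' hp
  obtain ⟨b, rfl⟩ := Nat.exists_eq_add_of_le' hq
  push_cast
  split_ifs with h
  · rw [Nat.cast_choose ℚ hpn, Nat.cast_choose ℚ (by omega),
      show N + 1 - a - (b + 1) = N - a - b by omega,
      show N + 2 - (a + 1) = N + 1 - a by omega]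
    have hN : (N : ℚ) + 2 - 1 ≠ 0 := by
      have : (0 : ℚ) ≤ N := by positivity
      linarith
    simp only [Nat.factorial_succ]
    push_cast
    field_simp
    ring
  · rw [Nat.choose_eq_zero_of_lt (show N + 1 - a < b + 1 by omega)]
    simp

theorem coeffM_pair_mul {d n p q : ℕ} (hn : 2 ≤ n) (hp : 1 ≤ p) (hq : 1 ≤ q) :
    ((n : ℚ) * (n - 1))⁻¹ * ((coeffM n ![p, q] : ℚ) *
        (1 / ((d : ℚ) ^ (p - 1) * (p - 1)!) * (1 / ((d : ℚ) ^ (q - 1) * (q - 1)!)))) =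
      trinomial (n - 2) (p - 1) (q - 1) /
        ((d : ℚ) ^ (p - 1) * p ! * ((d : ℚ) ^ (q - 1) * q !)) := by
  rw [← mul_assoc, inv_mul_eq_div, coeffM_pair_div hn hp hq,
    ← Nat.mul_factorial_pred (show p ≠ 0 by omega), ← Nat.mul_factorial_pred (show q ≠ 0 by omega)]
  push_cast
  rw [one_div_mul_one_div, div_mul_div_comm, mul_one]
  congr 1
  ring

end CoeffM

section NormalizedCount

variable {d n : ℕ}

theorem sum_prod_hookContentProd_eq_sum_coeffM {N k : ℕ} (hd : d ≠ 0) [NeZero k]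
    (x : Fin k → ℚ) :
    ∑ t ∈ Finset.range (N + 2), (-1) ^ t * ((N + 1).choose t : ℚ) * ∏ i, ∑ j, nodeWeight d j *
        (node d (x i) j * hookContentProd N (t - 1) (node d (x i) j)) =
      (N ! : ℚ) ^ k * ∑ p ∈ Fintype.piFinset fun _ : Fin k => Finset.Icc 1 (N + 1),
        (coeffM (N + 1) p : ℚ) * ∏ i, normP d (p i) (x i) := by
  have hexpand : ∀ t ∈ Finset.range (N + 2), ∏ i, ∑ j, nodeWeight d j *
        (node d (x i) j * hookContentProd N (t - 1) (node d (x i) j)) =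
      (N ! : ℚ) ^ k * ∑ p ∈ Fintype.piFinset fun _ : Fin k => Finset.Icc 1 (N + 1),
        (∏ i, ((N + 1 - t).choose (N + 1 - p i) : ℚ)) * ∏ i, normP d (p i) (x i) := fun t ht => by
    simp only [sum_nodeWeight_mul_hookContentProd hd (Finset.mem_range_succ_iff.1 ht),
      Finset.prod_mul_distrib, Finset.prod_const, Finset.card_univ, Fintype.card_fin,
      Finset.prod_univ_sum]
  have hcoeffM : ∀ p ∈ Fintype.piFinset fun _ : Fin k => Finset.Icc 1 (N + 1),
      (coeffM (N + 1) p : ℚ) = ∑ t ∈ Finset.range (N + 2), (-1) ^ t * ((N + 1).choose t : ℚ) *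
        ∏ i, ((N + 1 - t).choose (N + 1 - p i) : ℚ) := fun p hp => by
    rw [coeffM_eq_sum fun i => (Finset.mem_Icc.1 (Fintype.mem_piFinset.1 hp i)).2]
    push_cast
    rfl
  rw [Finset.sum_congr rfl fun t ht => congrArg _ (hexpand t ht),
    Finset.sum_congr rfl fun p hp => congrArg (· * _) (hcoeffM p hp)]
  simp only [Finset.sum_mul, Finset.mul_sum]
  rw [Finset.sum_comm]
  exact Finset.sum_congr rfl fun p _ => Finset.sum_congr rfl fun t _ => by ring

theorem transFactEnum_eq_sum_coeffM [NeZero d] {hn : 2 ≤ n} {c : Gddn d n}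
    (hc : IsCoxeterElement d n hn c) {k : ℕ} (hk : 1 ≤ k) (x : Fin k → ℚ) :
    (n : ℚ) ^ k / (Nat.card (Gddn d n) : ℚ) ^ (k - 1) * transFactEnum c x =
      ∑ p ∈ Fintype.piFinset fun _ : Fin k => Finset.Icc 1 n,
        (coeffM n p : ℚ) * ∏ i, normP d (p i) (x i) := by
  obtain ⟨N, rfl⟩ : ∃ N, n = N + 1 := ⟨n - 1, by omega⟩
  obtain ⟨l, rfl⟩ := Nat.exists_eq_add_of_le' hk
  have key := factorial_mul_transFactEnum hc x
  rw [Nat.add_sub_cancel, sum_prod_hookContentProd_eq_sum_coeffM (NeZero.ne d)] at key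
  set T := ∑ p ∈ Fintype.piFinset fun _ : Fin (l + 1) => Finset.Icc 1 (N + 1),
    (coeffM (N + 1) p : ℚ) * ∏ i, normP d (p i) (x i)
  have hd : (d : ℚ) ≠ 0 := Nat.cast_ne_zero.2 (NeZero.ne d)
  have hG : (d : ℚ) * Nat.card (Gddn d (N + 1)) = d ^ (N + 1) * (N + 1)! := by
    exact_mod_cast card_Gddn (d := d) (n := N + 1)
  have hG0 : (Nat.card (Gddn d (N + 1)) : ℚ) ≠ 0 := Nat.cast_ne_zero.2 Nat.card_pos.ne'
  have hfac : ((N + 1)! : ℚ) = ((N + 1 : ℕ) : ℚ) * N ! := by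
    rw [Nat.factorial_succ, Nat.cast_mul]
  have hne : ((N + 1)! : ℚ) * (d : ℚ) ^ (N + 1) * d ^ (l + 1) ≠ 0 := by positivity
  rw [Nat.add_sub_cancel, div_mul_eq_mul_div, div_eq_iff (pow_ne_zero _ hG0)]
  refine mul_left_cancel₀ hne ?_
  calc ((N + 1)! : ℚ) * (d : ℚ) ^ (N + 1) * d ^ (l + 1) *
        (((N + 1 : ℕ) : ℚ) ^ (l + 1) * transFactEnum c x)
      = ((N + 1 : ℕ) : ℚ) ^ (l + 1) * (d ^ ((l + 1) * (N + 1) + 1) *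
          ((N ! : ℚ) ^ (l + 1) * T)) := by rw [← key]; ring
    _ = d ^ ((l + 1) * (N + 1) + 1) * ((N + 1)! : ℚ) ^ (l + 1) * T := by
        rw [hfac, mul_pow]; ring
    _ = ((N + 1)! : ℚ) * (d : ℚ) ^ (N + 1) * d *
          ((d : ℚ) ^ (N + 1) * (N + 1)!) ^ l * T := by ring
    _ = _ := by rw [← hG]; ring

end NormalizedCount

section PolynomialIdentity

variable {d n : ℕ}

theorem sum_transFactCount [NeZero d] (c : Gddn d n) {k : ℕ} (x : Fin k → ℚ) :
    ∑ r ∈ Fintype.piFinset fun _ : Fin k => Finset.range (n + 1),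
      (transFactCount c r : ℚ) * ∏ i, x i ^ r i = transFactEnum c x := by
  classical
  rw [transFactEnum, ← Finset.sum_fiberwise_of_maps_to
    (g := fun (u : Fin k → Gddn d n) i => (u i : GenPerm d n).fixDim)
    (t := Fintype.piFinset fun _ : Fin k => Finset.range (n + 1))
    fun u _ => Fintype.mem_piFinset.2 fun i =>
      Finset.mem_range_succ_iff.2 (GenPerm.fixDim_le _)]
  refine Finset.sum_congr rfl fun r _ => ?_
  have hconst : ∀ u ∈ Finset.univ.filter (fun u : Fin k → Gddn d n =>
        IsTransitiveFactorization (Fin n × ZMod d) u c) |>.filter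
        fun u => (fun i => (u i : GenPerm d n).fixDim) = r,
      ∏ i, x i ^ (u i : GenPerm d n).fixDim = ∏ i, x i ^ r i := fun u hu => by
    rw [← (Finset.mem_filter.1 hu).2]
  rw [Finset.sum_congr rfl hconst, Finset.sum_const, nsmul_eq_mul, Finset.filter_filter,
    transFactCount, Nat.card_eq_fintype_card, Fintype.card_subtype]
  simp only [IsTransitiveFactorization, funext_iff, and_assoc]

theorem eval_aeval_X {σ : Type*} (x : σ → ℚ) (i : σ) (P : Polynomial ℚ) :
    MvPolynomial.eval x (Polynomial.aeval (MvPolynomial.X i : MvPolynomial σ ℚ) P) =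
      P.eval (x i) := by
  have h := Polynomial.aeval_algHom_apply (MvPolynomial.aeval x : MvPolynomial σ ℚ →ₐ[ℚ] ℚ)
    (MvPolynomial.X i) P
  rw [MvPolynomial.aeval_X, Polynomial.coe_aeval_eq_eval] at h
  rw [h, MvPolynomial.aeval_eq_eval]

theorem support_subset_of_transFactCount_eq_zero {M : Type*} [Zero M] (c : Gddn d n) {k : ℕ}
    {f : (Fin k → ℕ) → M} (hf : ∀ r, transFactCount c r = 0 → f r = 0) :
    f.support ⊆ Fintype.piFinset fun _ : Fin k => Finset.range (n + 1) := fun r hr =>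
  Fintype.mem_piFinset.2 fun i => Finset.mem_range_succ_iff.2
    (not_lt.1 fun hi => hr (hf r (transFactCount_eq_zero c r i hi)))

theorem support_subset_of_coeffM_eq_zero {M : Type*} [AddCommMonoid M] {k : ℕ}
    {f : (Fin k → ℕ) → M} (hf : ∀ p, coeffM n p = 0 → f p = 0) :
    (fun p => ∑ᶠ _ : ∀ i, 1 ≤ p i, f p).support ⊆
      Fintype.piFinset fun _ : Fin k => Finset.Icc 1 n := fun p hp => by
  have h1 : ∀ i, 1 ≤ p i := by
    by_contra h1
    exact hp (by simp only [h1, finsum_false])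
  have h : f p ≠ 0 := fun h => hp (by simp only [h, finsum_zero])
  exact Fintype.mem_piFinset.2 fun i =>
    Finset.mem_Icc.2 ⟨h1 i, not_lt.1 fun hi => h (hf p (coeffM_eq_zero n p i hi))⟩

theorem transFactCount_polynomial_identity [NeZero d] {hn : 2 ≤ n} {c : Gddn d n}
    (hc : IsCoxeterElement d n hn c) {k : ℕ} (hk : 1 ≤ k) :
    MvPolynomial.C ((n : ℚ) ^ k / (Nat.card (Gddn d n) : ℚ) ^ (k - 1)) *
        ∑ᶠ r : Fin k → ℕ, MvPolynomial.C (transFactCount c r : ℚ) *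
          ∏ i, (MvPolynomial.X i ^ r i : MvPolynomial (Fin k) ℚ)
      = ∑ᶠ (p : Fin k → ℕ) (_ : ∀ i, 1 ≤ p i),
          MvPolynomial.C (coeffM n p : ℚ) *
            ∏ i, (MvPolynomial.C (1 / ((d : ℚ) ^ (p i - 1) * ((p i - 1).factorial : ℚ))) *
              Polynomial.aeval (MvPolynomial.X i : MvPolynomial (Fin k) ℚ) (polyP d (p i))) := by
  rw [finsum_eq_sum_of_support_subset _ (support_subset_of_transFactCount_eq_zero c fun r h => by
      simp [h]),
    finsum_eq_sum_of_support_subset _ (support_subset_of_coeffM_eq_zero (n := n)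
      fun p h => by simp [h])]
  refine MvPolynomial.funext fun x => ?_
  simp only [map_mul, map_sum, MvPolynomial.eval_C, map_prod, map_pow, MvPolynomial.eval_X,
    sum_transFactCount, transFactEnum_eq_sum_coeffM hc hk]
  refine Finset.sum_congr rfl fun p hp => ?_
  have hp1 : ∀ i, 1 ≤ p i := fun i => (Finset.mem_Icc.1 (Fintype.mem_piFinset.1 hp i)).1
  simp only [hp1, implies_true, finsum_true, map_mul, MvPolynomial.eval_C, map_prod, eval_aeval_X,
    normP]

theorem finsum_fin_two {α M : Type*} [AddCommMonoid M] {f : (Fin 2 → α) → M}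
    (hf : f.support.Finite) : ∑ᶠ r, f r = ∑ᶠ (a : α) (b : α), f ![a, b] := by
  rw [← finsum_comp_equiv (finTwoArrowEquiv α).symm,
    finsum_curry _ (hf.preimage (finTwoArrowEquiv α).symm.injective.injOn)]
  rfl

end PolynomialIdentity

end TransitiveFactorizations

theorem theorem1p4_general (d n : ℕ) [NeZero d] (hn : 2 ≤ n) (c : Gddn d n)
    (hc : IsCoxeterElement d n hn c) :
    (MvPolynomial.C ((n : ℚ) / (((n : ℚ) - 1) * (Nat.card (Gddn d n) : ℚ))) *
        ∑ᶠ (r : ℕ) (s : ℕ), MvPolynomial.C (transFactCount c ![r, s] : ℚ) *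
          (MvPolynomial.X 0 ^ r * MvPolynomial.X 1 ^ s : MvPolynomial (Fin 2) ℚ)
      = ∑ᶠ (p : ℕ) (q : ℕ) (_ : 1 ≤ p ∧ 1 ≤ q),
          MvPolynomial.C (trinomial (n - 2) (p - 1) (q - 1) /
              ((d : ℚ) ^ (p - 1) * (p.factorial : ℚ) *
                ((d : ℚ) ^ (q - 1) * (q.factorial : ℚ)))) *
            (Polynomial.aeval (MvPolynomial.X 0 : MvPolynomial (Fin 2) ℚ) (polyP d p) *
              Polynomial.aeval (MvPolynomial.X 1 : MvPolynomial (Fin 2) ℚ) (polyP d q))) ∧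
    ∀ k : ℕ, 1 ≤ k →
      MvPolynomial.C ((n : ℚ) ^ k / (Nat.card (Gddn d n) : ℚ) ^ (k - 1)) *
        ∑ᶠ r : Fin k → ℕ, MvPolynomial.C (transFactCount c r : ℚ) *
          ∏ i, (MvPolynomial.X i ^ r i : MvPolynomial (Fin k) ℚ)
      = ∑ᶠ (p : Fin k → ℕ) (_ : ∀ i, 1 ≤ p i),
          MvPolynomial.C (coeffM n p : ℚ) *
            ∏ i, (MvPolynomial.C (1 / ((d : ℚ) ^ (p i - 1) * ((p i - 1).factorial : ℚ))) *
              Polynomial.aeval (MvPolynomial.X i : MvPolynomial (Fin k) ℚ) (polyP d (p i))) := by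
  refine ⟨?_, fun k hk => transFactCount_polynomial_identity hc hk⟩
  have h := transFactCount_polynomial_identity hc one_le_two
  rw [finsum_fin_two ((Finset.finite_toSet _).subset
      (support_subset_of_transFactCount_eq_zero c fun r h => by simp [h])),
    finsum_fin_two ((Finset.finite_toSet _).subset
      (support_subset_of_coeffM_eq_zero (n := n) fun p h => by simp [h]))] at h
  simp only [Fin.prod_univ_two, Fin.forall_fin_two, Matrix.cons_val_zero, Matrix.cons_val_one] at h
  have hconst : (n : ℚ) / (((n : ℚ) - 1) * (Nat.card (Gddn d n) : ℚ)) =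
      ((n : ℚ) * (n - 1))⁻¹ * ((n : ℚ) ^ 2 / (Nat.card (Gddn d n) : ℚ) ^ (2 - 1)) := by
    have hn0 : (n : ℚ) ≠ 0 := Nat.cast_ne_zero.2 (by omega)
    rw [Nat.add_one_sub_one, pow_one, div_eq_mul_inv, div_eq_mul_inv, mul_inv, mul_inv]
    field_simp
  rw [hconst, map_mul, mul_assoc, h, mul_finsum]
  refine finsum_congr fun p => (mul_finsum _ _).trans (finsum_congr fun q => ?_)
  by_cases hpq : 1 ≤ p ∧ 1 ≤ q
  · simp only [Fin.forall_fin_two, Matrix.cons_val_zero, Matrix.cons_val_one, hpq, and_self,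
      finsum_true]
    simp only [← coeffM_pair_mul hn hpq.1 hpq.2, map_mul]
    ring
  · simp only [Fin.forall_fin_two, Matrix.cons_val_zero, Matrix.cons_val_one, hpq, finsum_false,
      mul_zero]

theorem theorem1p4 (d n : ℕ) (hd : 1 < d) (hn : 2 ≤ n) (c : Gddn d n)
    (hc : IsCoxeterElement d n hn c) :
    -- two factors
    (MvPolynomial.C ((n : ℚ) / (((n : ℚ) - 1) * (Nat.card (Gddn d n) : ℚ))) *
        ∑ᶠ (r : ℕ) (s : ℕ), MvPolynomial.C (transFactCount c ![r, s] : ℚ) *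
          (MvPolynomial.X 0 ^ r * MvPolynomial.X 1 ^ s : MvPolynomial (Fin 2) ℚ)
      = ∑ᶠ (p : ℕ) (q : ℕ) (_ : 1 ≤ p ∧ 1 ≤ q),
          MvPolynomial.C (trinomial (n - 2) (p - 1) (q - 1) /
              ((d : ℚ) ^ (p - 1) * (p.factorial : ℚ) *
                ((d : ℚ) ^ (q - 1) * (q.factorial : ℚ)))) *
            (Polynomial.aeval (MvPolynomial.X 0 : MvPolynomial (Fin 2) ℚ) (polyP d p) *
              Polynomial.aeval (MvPolynomial.X 1 : MvPolynomial (Fin 2) ℚ) (polyP d q))) ∧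
    -- `k` factors
    ∀ k : ℕ, 1 ≤ k →
      MvPolynomial.C ((n : ℚ) ^ k / (Nat.card (Gddn d n) : ℚ) ^ (k - 1)) *
        ∑ᶠ r : Fin k → ℕ, MvPolynomial.C (transFactCount c r : ℚ) *
          ∏ i, (MvPolynomial.X i ^ r i : MvPolynomial (Fin k) ℚ)
      = ∑ᶠ (p : Fin k → ℕ) (_ : ∀ i, 1 ≤ p i),
          MvPolynomial.C (coeffM n p : ℚ) *
            ∏ i, (MvPolynomial.C (1 / ((d : ℚ) ^ (p i - 1) * ((p i - 1).factorial : ℚ))) *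
              Polynomial.aeval (MvPolynomial.X i : MvPolynomial (Fin k) ℚ) (polyP d (p i))) := by
  have : NeZero d := ⟨by omega⟩
  exact theorem1p4_general d n hn c hc
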